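/- Theorem. There is a polynomial $p$ with natural coefficients such that the following holds. Let $N, T_{inner}, T_{outer}, T_{rep}$ be non-negative integers with $T_{inner}\ge 10$, and let $IMP_{low}, IMP_{up}\ge 0$ be real numbers. There is a deterministic distributed algorithm in the LOCAL model (synchronous rounds, messages and local computation unbounded; it may depend on the six parameters $N,T_{inner},T_{outer},T_{rep},IMP_{low},IMP_{up}$, which are known to all nodes) that runs for at most $$(T_{outer}+T_{rep})\cdot p(T_{inner})\cdot \log^* N$$ rounds and has the following property. ($\log^*N$ is the least $k\ge 0$ such that applying the binary logarithm $k$ times to $N$ gives a value at most $1$; $0^0=1$.) Let $H$ be any finite bipartite graph with given bipartition $V(H)=U\sqcup V$, in which the nodes of $V$ have pairwise distinct identifiers from $\{1,\dots,N\}$, and let $imp_{low},imp_{up}\in\mathbb{R}_{\ge 0}^U$ satisfy $\sum_{u\in U}imp_{low}(u)\le IMP_{low}$ and $\sum_{u\in U}imp_{up}(u)\le IMP_{up}$. Write $\Gamma(u)\subseteq V$ for the set of neighbours of $u\in U$ in $H$. Initially each $v\in V$ knows its identifier and each $u\in U$ knows $imp_{low}(u)$ and $imp_{up}(u)$. Run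 on $H$, the algorithm computes a set $V^{sub}\subseteq V$, numbers $bad(u)\in\{0,1,2,\dots\}$ for $u\in U$, and a set $U^{bad}\subseteq U$ (each $v\in V$ outputs whether $v\in V^{sub}$, and each $u\in U$ outputs $bad(u)$ and whether $u\in U^{bad}$) such that 1. $\displaystyle\sum_{u\in U} imp_{up}(u)\cdot 2^{bad(u)}\le 11^{T_{rep}+T_{outer}}\, IMP_{up}$; 2. for every $u\in U$, $\displaystyle |\Gamma(u)\cap V^{sub}|\le (T_{rep})^{T_{outer}}\max\Big(e^{-(T_{inner}-1)T_{outer}+bad(u)/T_{inner}^2}\,|\Gamma(u)|,\; e^{100T_{inner}}\Big)$; 3. $\displaystyle U^{bad}=\Big\{u\in U:\ \tfrac{|\Gamma(u)\cap V^{sub}|}{|\Gamma(u)|}<e^{-(T_{inner}+1)T_{outer}}\ \text{ and }\ |\Gamma(u)|\ge e^{(T_{inner}+1)T_{outer}}\cdot e^{100T_{inner}}\Big\}$; 4. $\displaystyle\sum_{u\in U^{bad}} imp_{low}(u)\le (T_{rep}+1)^{T_{outer}}\cdot 0.9^{T_{rep}}\cdot IMP_{low}$. -/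

import Mathlib

/-- A deterministic algorithm of the synchronous `LOCAL` model.  All nodes run the same program and a
node initially knows only its own input.  In every round each node sends a message (of unbounded
size) to all of its neighbours, receives the messages of its neighbours, and updates its state by an
arbitrary function.  Messages are broadcast and arrive as a multiset, so there are no port
numbers and nodes have no identifiers other than those that their inputs contain. -/
structure LocalAlgorithm (In Out : Type) where
  /-- local states of a node -/
  State : Type
  /-- messages -/
  Msg : Type
  /-- the initial state, computed from the local input -/
  init : In → State
  /-- the message sent to all neighbours -/
  send : State → Msg
  /-- the new state, from the old state and the received messages -/
  recv : State → Multiset Msg → State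
  /-- the output that is read off from a state -/
  out : State → Out

namespace LocalAlgorithm

open Classical in
/-- The state of every node after a given number of rounds on the graph `G` with inputs `inp`. -/
noncomputable def stateAfter {In Out : Type} (A : LocalAlgorithm In Out) {W : Type*} [Fintype W]
    (G : SimpleGraph W) (inp : W → In) : ℕ → W → A.State
  | 0, w => A.init (inp w)
  | t + 1, w => A.recv (A.stateAfter G inp t w)
      ((Finset.univ.filter fun x => G.Adj w x).val.map fun x => A.send (A.stateAfter G inp t x))

/-- The outputs of all nodes when the algorithm is stopped after `r` rounds. -/
noncomputable def outputAfter {In Out : Type} (A : LocalAlgorithm In Out) {W : Type*} [Fintype W]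
    (G : SimpleGraph W) (inp : W → In) (r : ℕ) (w : W) : Out :=
  A.out (A.stateAfter G inp r w)

end LocalAlgorithm

/-- The iterated logarithm `log* n`: how often the binary logarithm has to be applied to `n` until
the result is at most `1`. -/
noncomputable def logStar (n : ℕ) : ℕ := sInf {k : ℕ | (Real.logb 2)^[k] (n : ℝ) ≤ 1}

/-- The infimum in the definition of `logStar` is attained. -/
theorem logStar_spec (n : ℕ) : (Real.logb 2)^[logStar n] (n : ℝ) ≤ 1 := by
  have key : ∀ m : ℕ, ∀ x : ℝ, x ≤ m + 1 → ∃ k : ℕ, (Real.logb 2)^[k] x ≤ 1 := by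
    intro m
    induction m with
    | zero => intro x hx; exact ⟨0, by simpa using hx⟩
    | succ m ih =>
      intro x hx
      by_cases h1 : x ≤ 1
      · exact ⟨0, by simpa using h1⟩
      · have h1' : 1 < x := not_le.mp h1
        have hlog : Real.logb 2 x ≤ m + 1 := by
          rw [Real.logb_le_iff_le_rpow (by norm_num) (by linarith)]
          have h2 : ((m + 1 : ℕ) : ℝ) + 1 ≤ 2 ^ (m + 1) := by
            have := (Nat.lt_two_pow_self (n := m + 1))
            exact_mod_cast this
          have h3 : (2 : ℝ) ^ ((m : ℝ) + 1) = 2 ^ (m + 1) := by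
            rw [← Real.rpow_natCast]; push_cast; rfl
          rw [h3]; linarith
        obtain ⟨k, hk⟩ := ih _ hlog
        exact ⟨k + 1, by rwa [Function.iterate_succ_apply]⟩
  exact Nat.sInf_mem (s := {k : ℕ | (Real.logb 2)^[k] (n : ℝ) ≤ 1}) (key n n (by linarith))

/-- The neighbours in `V` of a node `u ∈ U`, for a graph on `U ⊔ V`. -/
def bipNbrs {U V : Type*} (H : SimpleGraph (U ⊕ V)) (u : U) : Set V :=
  {v | H.Adj (Sum.inl u) (Sum.inr v)}

-- One sampling step should keep each node of V with probability 1 − δ, independently. By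
-- Chebyshev's inequality, few nodes of U (by weight) would then see a kept fraction differing from
-- 1 − δ by more than ε. This uses only second moments, so it can be derandomised with the quadratic
-- potential Σ w(x)/d(x)² · (Σ z(y))², where z(y) is 0 while y is undecided and then −δ (kept) or 1
-- − δ (dropped). A node picks the sign opposite to its correlation with the earlier decisions, so
-- cross terms never increase the potential (`deviation_update_le`).
--
-- Deciding nodes one at a time would take too long, so the colour classes of a defective colouring
-- decide simultaneously. The price is the weight of equally coloured pairs with a common neighbour.
-- A colouring with O(B⁴) colours and at most a 2/B fraction of additional collisions is found in
-- O(log* N) rounds by Linial's polynomial hashing, in which every node chooses the evaluation point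
-- with the fewest collisions (`collisions_le_of_hash`, `Solves.defectiveColouring`).
--
-- With δ = 1/T² and ε = 1/(4T³), T³ steps reduce degrees by a factor between e^(−(T+1)) and
-- e^(−(T−1)), as long as no step fails (`Solves.inner`). Every failure at x increments bad(x),
-- doubles the upper importance of x and loosens its upper bound by a factor e^(1/T²). The total
-- upper importance grows by at most a factor 10, and the nodes with a failure carry at most 0.9 of
-- the lower importance budget.
--
-- The full algorithm recurses on the pair (T_outer, T_rep) after one such sampling
-- (`Solves.outer`). One branch continues inside the sampled set with T_outer − 1 and the lower
-- importance of the good nodes. The other restarts on the whole graph with T_rep − 1 and the lower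
-- importance of the failed nodes. The branches run in parallel and the results are united: too few
-- neighbours in the union means too few in each branch, so each node needs to be charged in one
-- branch only.

universe u v

/-! ### Full-information views and composition of local algorithms -/

/-- The full information that a node can gather in a given number of rounds. -/
def View (I : Type) : ℕ → Type
  | 0 => I
  | t + 1 => View I t × Multiset (View I t)

/-- The input of the node at the root of a view. -/
def View.root {I : Type} : ∀ t, View I t → I
  | 0, x => x
  | t + 1, x => View.root t x.1

section LocalModel

open scoped Classical

/-- The view of every node after a given number of rounds. -/
noncomputable def viewAfter {I : Type} {W : Type*} [Fintype W] (G : SimpleGraph W) (inp : W → I) :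
    ∀ t, W → View I t
  | 0, w => inp w
  | t + 1, w => (viewAfter G inp t w, (Finset.univ.filter (G.Adj w)).val.map (viewAfter G inp t))

theorem root_viewAfter {I : Type} {W : Type*} [Fintype W] (G : SimpleGraph W) (inp : W → I)
    (t : ℕ) (w : W) : View.root t (viewAfter G inp t w) = inp w := by
  induction t with
  | zero => rfl
  | succ t ih => exact ih

/-- The algorithm that collects the view of radius `r` and applies `f` to it. -/
noncomputable def viewAlgorithm {I O : Type} [Nonempty O] (r : ℕ) (f : View I r → O) :
    LocalAlgorithm I O where
  State := Σ t, View I t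
  Msg := Σ t, View I t
  init := fun i => ⟨0, i⟩
  send := id
  -- All nodes have run equally many rounds, so the default `s.2` for a message of another radius is
  -- never used.
  recv := fun s ms => ⟨s.1 + 1, (s.2, ms.map fun m => if h : m.1 = s.1 then h ▸ m.2 else s.2)⟩
  out := fun s => if h : s.1 = r then f (h ▸ s.2) else Classical.arbitrary O

theorem viewAlgorithm_outputAfter {I O : Type} [Nonempty O] (r : ℕ) (f : View I r → O)
    {W : Type*} [Fintype W] (G : SimpleGraph W) (inp : W → I) (w : W) :
    (viewAlgorithm r f).outputAfter G inp r w = f (viewAfter G inp r w) := by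
  have key : ∀ t w, (viewAlgorithm r f).stateAfter G inp t w = ⟨t, viewAfter G inp t w⟩ := by
    intro t
    induction t with
    | zero => intro w; rfl
    | succ t ih =>
      intro w
      simp only [LocalAlgorithm.stateAfter, ih]
      simp [viewAlgorithm, viewAfter, Multiset.map_map]
  rw [LocalAlgorithm.outputAfter, key]
  simp [viewAlgorithm]

/-- Turn a view of radius `r + t` into the view of radius `t` for the labels that `f` computes. -/
def View.lift {I J : Type} {r : ℕ} (f : View I r → J) : ∀ t, View I (r + t) → View J t
  | 0, x => f x
  | t + 1, x => (View.lift f t x.1, x.2.map (View.lift f t))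

/-- Because of this, running one algorithm after another is composition of functions on views. -/
theorem lift_viewAfter {I J : Type} {r : ℕ} (f : View I r → J) {W : Type*} [Fintype W]
    (G : SimpleGraph W) (inp : W → I) (t : ℕ) (w : W) :
    View.lift f t (viewAfter G inp (r + t) w) =
      viewAfter G (fun w => f (viewAfter G inp r w)) t w := by
  induction t generalizing w with
  | zero => rfl
  | succ t ih =>
    refine Prod.ext (ih w) ?_
    refine (Multiset.map_map _ _ _).trans (Multiset.map_congr rfl fun x _ => ih x)

/-- The neighbours in `V` of a node of `U`. -/
noncomputable def nbU {U : Type u} {V : Type v} [Fintype V] (H : SimpleGraph (U ⊕ V)) (x : U) :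
    Finset V := Finset.univ.filter fun y => H.Adj (Sum.inl x) (Sum.inr y)

/-- The neighbours in `U` of a node of `V`. -/
noncomputable def nbV {U : Type u} {V : Type v} [Fintype U] (H : SimpleGraph (U ⊕ V)) (y : V) :
    Finset U := Finset.univ.filter fun x => H.Adj (Sum.inl x) (Sum.inr y)

/-- Relations between the inputs and outputs of the two sides of a bipartite graph. -/
abbrev Spec (X Y X' Y' : Type) :=
  ∀ (U : Type u) (V : Type v) [Fintype U] [Fintype V], SimpleGraph (U ⊕ V) →
    (U → X) → (V → Y) → (U → X') → (V → Y') → Prop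

/-- Some `r`-round algorithm meets the specification on all bipartite graphs. -/
def Solves {X Y X' Y' : Type} (r : ℕ) (S : Spec.{u, v} X Y X' Y') : Prop :=
  ∃ f : View (X ⊕ Y) r → X' ⊕ Y', ∀ (U : Type u) (V : Type v) [Fintype U] [Fintype V]
    (H : SimpleGraph (U ⊕ V)), H ≤ completeBipartiteGraph U V → ∀ (a : U → X) (b : V → Y),
    ∃ a' b', (∀ w, f (viewAfter H (Sum.map a b) r w) = Sum.map a' b' w) ∧ S U V H a b a' b'

variable {X Y X' Y' X'' Y'' : Type} {r r' : ℕ}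

theorem Solves.mono {S S' : Spec.{u, v} X Y X' Y'} (h : Solves r S)
    (hS : ∀ (U : Type u) (V : Type v) [Fintype U] [Fintype V] (H : SimpleGraph (U ⊕ V)) a b a' b',
      S U V H a b a' b' → S' U V H a b a' b') : Solves r S' := by
  obtain ⟨f, hf⟩ := h
  refine ⟨f, fun U V _ _ H hH a b => ?_⟩
  obtain ⟨a', b', h1, h2⟩ := hf U V H hH a b
  exact ⟨a', b', h1, hS U V H a b a' b' h2⟩

theorem Solves.comp {S : Spec.{u, v} X Y X' Y'} {S' : Spec.{u, v} X' Y' X'' Y''}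
    (h : Solves r S) (h' : Solves r' S') :
    Solves (r + r') (fun U V _ _ H a b a'' b'' =>
      ∃ a' b', S U V H a b a' b' ∧ S' U V H a' b' a'' b'') := by
  obtain ⟨f, hf⟩ := h
  obtain ⟨f', hf'⟩ := h'
  refine ⟨fun x => f' (View.lift f r' x), fun U V _ _ H hH a b => ?_⟩
  obtain ⟨a', b', h1, h2⟩ := hf U V H hH a b
  obtain ⟨a'', b'', h3, h4⟩ := hf' U V H hH a' b'
  refine ⟨a'', b'', fun w => ?_, a', b', h2, h4⟩
  show f' (View.lift f r' (viewAfter H (Sum.map a b) (r + r') w)) = _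
  rw [lift_viewAfter, ← h3]
  congr 2
  funext w
  exact h1 w

theorem Solves.lift {S : Spec.{u, v} X Y X' Y'} (h : Solves r S) (hr : r ≤ r') : Solves r' S := by
  obtain ⟨k, rfl⟩ := Nat.exists_eq_add_of_le hr
  induction k with
  | zero => exact h
  | succ k ih =>
    obtain ⟨f, hf⟩ := ih (by omega)
    exact ⟨fun x => f x.1, hf⟩

theorem Solves.prod [Nonempty X'] [Nonempty X''] {S : Spec.{u, v} X Y X' Y'}
    {S' : Spec.{u, v} X Y X'' Y''} (h : Solves r S) (h' : Solves r S') :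
    Solves r (fun U V _ _ H a b (a' : U → X' × X'') (b' : V → Y' × Y'') =>
      S U V H a b (fun x => (a' x).1) (fun x => (b' x).1) ∧
      S' U V H a b (fun x => (a' x).2) (fun x => (b' x).2)) := by
  obtain ⟨f, hf⟩ := h
  obtain ⟨f', hf'⟩ := h'
  refine ⟨fun x => match f x, f' x with
    | Sum.inl p, Sum.inl q => Sum.inl (p, q)
    | Sum.inr p, Sum.inr q => Sum.inr (p, q)
    -- Both algorithms respect the side of a node, so the mixed case does not occur.
    | _, _ => Sum.inl (Classical.arbitrary _), fun U V _ _ H hH a b => ?_⟩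
  obtain ⟨a', b', h1, h2⟩ := hf U V H hH a b
  obtain ⟨a'', b'', h3, h4⟩ := hf' U V H hH a b
  refine ⟨fun x => (a' x, a'' x), fun x => (b' x, b'' x), fun w => ?_, h2, h4⟩
  simp only [h1 w, h3 w]
  cases w <;> rfl

theorem Solves.map (φ : X → X') (ψ : Y → Y') :
    Solves 0 (fun (U : Type u) (V : Type v) _ _ _ a b (a' : U → X') (b' : V → Y') =>
      a' = (fun x => φ (a x)) ∧ b' = fun y => ψ (b y)) :=
  ⟨Sum.map φ ψ, fun U V _ _ H _ a b => ⟨_, _, fun w => by cases w <;> rfl, rfl, rfl⟩⟩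

/-- Apply local functions to the inputs. -/
theorem Solves.premap {S : Spec.{u, v} X' Y' X'' Y''} (h : Solves r S) (φ : X → X') (ψ : Y → Y') :
    Solves r (fun U V _ _ H (a : U → X) (b : V → Y) a' b' =>
      S U V H (fun x => φ (a x)) (fun y => ψ (b y)) a' b') := by
  have := ((Solves.map.{u, v} φ ψ).comp h).lift (Nat.zero_add r).le
  refine this.mono ?_
  rintro U V _ _ H a b a' b' ⟨_, _, ⟨rfl, rfl⟩, h⟩
  exact h

/-- Apply local functions to the outputs and the inputs. -/
theorem Solves.postmap [Nonempty X] [Nonempty X'] {S : Spec.{u, v} X Y X' Y'} (h : Solves r S)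
    (φ : X → X' → X'') (ψ : Y → Y' → Y'') :
    Solves r (fun U V _ _ H a b (a'' : U → X'') (b'' : V → Y'') => ∃ a' b', S U V H a b a' b' ∧
      a'' = (fun x => φ (a x) (a' x)) ∧ b'' = fun y => ψ (b y) (b' y)) := by
  have h1 := ((Solves.map.{u, v} (id : X → X) (id : Y → Y)).lift (Nat.zero_le r)).prod h
  refine (h1.comp (Solves.map (fun p => φ p.1 p.2) (fun p => ψ p.1 p.2))).mono ?_
  rintro U V _ _ H a b a'' b'' ⟨a', b', ⟨⟨h1, h2⟩, h3⟩, h4, h5⟩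
  refine ⟨_, _, h3, ?_, ?_⟩
  · rw [h4]; funext x; rw [congrFun h1 x]; rfl
  · rw [h5]; funext x; rw [congrFun h2 x]; rfl

/-- Run a second algorithm on labels computed from the inputs and outputs of a first one,
and keep the inputs and outputs of the first one. -/
theorem Solves.bind {Z Z' T T' : Type} [Nonempty X] [Nonempty X'] [Nonempty X'']
    {S : Spec.{u, v} X Y X' Y'} (h : Solves r S) (φ : X → X' → Z) (ψ : Y → Y' → Z')
    {S' : Spec.{u, v} Z Z' X'' Y''} (h' : Solves r' S')
    (σ : X → X' → X'' → T) (τ : Y → Y' → Y'' → T') :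
    Solves (r + r') (fun U V _ _ H a b (a₃ : U → T) (b₃ : V → T') => ∃ a' b' a'' b'',
      S U V H a b a' b' ∧
      S' U V H (fun x => φ (a x) (a' x)) (fun y => ψ (b y) (b' y)) a'' b'' ∧
      a₃ = (fun x => σ (a x) (a' x) (a'' x)) ∧ b₃ = fun y => τ (b y) (b' y) (b'' y)) := by
  have h1 := h.postmap (fun x x' => (x, x')) (fun y y' => (y, y'))
  have h2 := (h'.premap (fun p : X × X' => φ p.1 p.2) (fun p : Y × Y' => ψ p.1 p.2)).postmap
    (fun p x'' => σ p.1 p.2 x'') (fun p y'' => τ p.1 p.2 y'')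
  refine (h1.comp h2).mono ?_
  rintro U V _ _ H a b a₃ b₃ ⟨_, _, ⟨a', b', h1, rfl, rfl⟩, a'', b'', h2, h3, h4⟩
  exact ⟨a', b', a'', b'', h1, h2, h3, h4⟩

theorem map_view_inl {U : Type u} {V : Type v} [Fintype U] [Fintype V] {H : SimpleGraph (U ⊕ V)}
    (hH : H ≤ completeBipartiteGraph U V) (x : U) :
    (Finset.univ.filter (H.Adj (Sum.inl x))).val = (nbU H x).val.map Sum.inr := by
  have : Finset.univ.filter (H.Adj (Sum.inl x)) =
      (nbU H x).map ⟨Sum.inr, Sum.inr_injective⟩ := by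
    ext w
    rcases w with w | w
    · have : ¬ H.Adj (Sum.inl x) (Sum.inl w) := fun h => by simpa using hH h
      simp [this]
    · simp [nbU]
  rw [this]; rfl

theorem map_view_inr {U : Type u} {V : Type v} [Fintype U] [Fintype V] {H : SimpleGraph (U ⊕ V)}
    (hH : H ≤ completeBipartiteGraph U V) (y : V) :
    (Finset.univ.filter (H.Adj (Sum.inr y))).val = (nbV H y).val.map Sum.inl := by
  have : Finset.univ.filter (H.Adj (Sum.inr y)) =
      (nbV H y).map ⟨Sum.inl, Sum.inl_injective⟩ := by
    ext w
    rcases w with w | w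
    · simp [nbV, H.adj_comm]
    · have : ¬ H.Adj (Sum.inr y) (Sum.inr w) := fun h => by simpa using hH h
      simp [this]
  rw [this]; rfl

/-- One round of communication. -/
theorem Solves.round (g : X → Multiset Y → X') (h : Y → Multiset X → Y') :
    Solves 1 (fun (U : Type u) (V : Type v) _ _ H a b (a' : U → X') (b' : V → Y') =>
      a' = (fun x => g (a x) ((nbU H x).val.map b)) ∧
      b' = fun y => h (b y) ((nbV H y).val.map a)) := by
  refine ⟨fun s => match s.1 with
    | Sum.inl x => Sum.inl (g x (Multiset.filterMap Sum.getRight? s.2))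
    | Sum.inr y => Sum.inr (h y (Multiset.filterMap Sum.getLeft? s.2)),
    fun U V _ _ H hH a b => ⟨_, _, fun w => ?_, rfl, rfl⟩⟩
  rcases w with x | y
  · have key : Multiset.filterMap Sum.getRight? (Multiset.map (Sum.map a b)
        (Multiset.map Sum.inr (nbU H x).val)) = (nbU H x).val.map b := by
      rw [Multiset.map_map, Multiset.filterMap_map, ← Multiset.filterMap_eq_map]
      rfl
    rw [← map_view_inl hH] at key
    exact congrArg (fun s => Sum.inl (g (a x) s)) key
  · have key : Multiset.filterMap Sum.getLeft? (Multiset.map (Sum.map a b)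
        (Multiset.map Sum.inl (nbV H y).val)) = (nbV H y).val.map a := by
      rw [Multiset.map_map, Multiset.filterMap_map, ← Multiset.filterMap_eq_map]
      rfl
    rw [← map_view_inr hH] at key
    exact congrArg (fun s => Sum.inr (h (b y) s)) key

/-- The subgraph in which the nodes of `V` outside `K` are isolated. -/
def restrictGraph {U : Type u} {V : Type v} (H : SimpleGraph (U ⊕ V)) (K : V → Prop) :
    SimpleGraph (U ⊕ V) where
  Adj w w' := H.Adj w w' ∧ Sum.elim (fun _ => True) K w ∧ Sum.elim (fun _ => True) K w'
  symm := ⟨fun _ _ h => ⟨h.1.symm, h.2.2, h.2.1⟩⟩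
  loopless := ⟨fun _ h => H.loopless.irrefl _ h.1⟩

theorem nbU_restrictGraph {U : Type u} {V : Type v} [Fintype V] (H : SimpleGraph (U ⊕ V))
    (K : V → Prop) (x : U) : nbU (restrictGraph H K) x = (nbU H x).filter K := by
  ext y
  simp [nbU, restrictGraph]

/-- Whether the root of a view is a node of `U` or a marked node of `V`. -/
def View.Alive {t : ℕ} (s : View (X ⊕ (Y × Prop)) t) : Prop :=
  Sum.elim (fun _ => True) (fun p => p.2) (View.root t s)

/-- Delete the edges at unmarked nodes from a view. -/
noncomputable def View.trim : ∀ t, View (X ⊕ (Y × Prop)) t → View (X ⊕ Y) t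
  | 0, s => Sum.map id Prod.fst s
  | t + 1, s => (View.trim t s.1,
      if View.Alive s.1 then (s.2.filter View.Alive).map (View.trim t) else 0)

/-- The input at the root stays readable in every view, so a node can discard what it hears from
unmarked nodes. This simulates the subgraph without changing the vertex types. -/
theorem trim_viewAfter {U : Type u} {V : Type v} [Fintype U] [Fintype V] (H : SimpleGraph (U ⊕ V))
    (a : U → X) (b : V → Y × Prop) (t : ℕ) (w : U ⊕ V) :
    View.trim t (viewAfter H (Sum.map a b) t w) =
      viewAfter (restrictGraph H fun y => (b y).2) (Sum.map a fun y => (b y).1) t w := by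
  have alive : ∀ t w, View.Alive (viewAfter H (Sum.map a b) t w) ↔
      Sum.elim (fun _ => True) (fun y => (b y).2) w := by
    intro t w
    rw [View.Alive, root_viewAfter]
    cases w <;> rfl
  induction t generalizing w with
  | zero => cases w <;> rfl
  | succ t ih =>
    refine Prod.ext (ih w) ?_
    show (if View.Alive (viewAfter H (Sum.map a b) t w) then _ else _) = _
    rw [alive]
    show _ = Multiset.map _ (Finset.filter _ _).val
    split_ifs with hw
    · show Multiset.map _ (Multiset.filter _ (Multiset.map _ (Finset.filter _ _).val)) = _
      rw [Multiset.filter_map, Multiset.map_map, ← Finset.filter_val, Finset.filter_filter]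
      have : (Finset.univ.filter fun x => H.Adj w x ∧
          (View.Alive ∘ viewAfter H (Sum.map a b) t) x) =
          Finset.univ.filter ((restrictGraph H fun y => (b y).2).Adj w) := by
        ext x
        simp [restrictGraph, alive, hw]
      rw [this]
      exact Multiset.map_congr rfl fun x _ => ih x
    · have : Finset.univ.filter ((restrictGraph H fun y => (b y).2).Adj w) = ∅ := by
        ext x
        simp [restrictGraph, hw]
      rw [this]; rfl

/-- Run an algorithm on the subgraph of the marked nodes. -/
theorem Solves.restrict {S : Spec.{u, v} X Y X' Y'} (h : Solves r S) :
    Solves r (fun U V _ _ H a (b : V → Y × Prop) a' b' =>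
      S U V (restrictGraph H fun y => (b y).2) a (fun y => (b y).1) a' b') := by
  obtain ⟨f, hf⟩ := h
  refine ⟨fun s => f (View.trim r s), fun U V _ _ H hH a b => ?_⟩
  obtain ⟨a', b', h1, h2⟩ := hf U V (restrictGraph H fun y => (b y).2)
    (fun _ _ h => hH h.1) a (fun y => (b y).1)
  refine ⟨a', b', fun w => ?_, h2⟩
  rw [← h1 w, ← trim_viewAfter]

end LocalModel

/-! ### One step of colour reduction by polynomial hashing -/

section Colouring

open scoped Classical

/-- Polynomials of degree less than `k` over a prime field, as a family of hash functions. -/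
theorem exists_hash_family (p k : ℕ) (hp : p.Prime) : ∃ h : ℕ → ℕ → ℕ, (∀ c x, h c x < p) ∧
    ∀ c c', c < p ^ k → c' < p ^ k → c ≠ c' →
      ((Finset.range p).filter fun x => h c x = h c' x).card ≤ k := by
  have : Fact p.Prime := ⟨hp⟩
  have e : Fin (p ^ k) ≃ Polynomial.degreeLT (ZMod p) k :=
    (Fintype.equivOfCardEq (by simp [ZMod.card])).trans
      (Polynomial.degreeLTEquiv (ZMod p) k).symm.toEquiv
  -- Distinct colours below p^k get distinct polynomials, whose difference has at most k roots.
  -- Larger colours are irrelevant.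
  let P : ℕ → Polynomial (ZMod p) := fun c => if h : c < p ^ k then (e ⟨c, h⟩ : _) else 0
  refine ⟨fun c x => ((P c).eval (x : ZMod p)).val, fun c x => ZMod.val_lt _, ?_⟩
  intro c c' hc hc' hne
  have hP : ∀ c, (P c).degree < k ∨ k = 0 := by
    intro c
    left
    by_cases h : c < p ^ k
    · simp only [P, h, dif_pos]
      exact Polynomial.mem_degreeLT.mp (e ⟨c, h⟩).2
    · simp [P, h, bot_lt_iff_ne_bot]
  have hsub : P c - P c' ≠ 0 := by
    rw [sub_ne_zero]
    simp only [P, hc, hc', dif_pos]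
    intro h
    have := e.injective (Subtype.ext h)
    simp only [Fin.mk.injEq] at this
    exact hne this
  have hdeg : (P c - P c').natDegree ≤ k := by
    rcases hP c with h1 | h1
    · rcases hP c' with h2 | h2
      · exact Polynomial.natDegree_le_of_degree_le
          ((Polynomial.degree_sub_le _ _).trans (max_le h1.le h2.le))
      · subst h2; simp at hc hc'; omega
    · subst h1; simp at hc hc'; omega
  refine le_trans ?_ ((Polynomial.card_roots' _).trans hdeg)
  refine le_trans ?_ (Multiset.toFinset_card_le _)
  refine Finset.card_le_card_of_injOn (fun x => (x : ZMod p)) ?_ ?_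
  · intro x hx
    simp only [Finset.coe_filter, Finset.mem_range, Set.mem_ofPred_eq] at hx
    simp only [Finset.mem_coe, Multiset.mem_toFinset, Polynomial.mem_roots hsub,
      Polynomial.IsRoot, Polynomial.eval_sub, sub_eq_zero]
    exact ZMod.val_injective p hx.2
  · intro x hx y hy hxy
    simp only [Finset.coe_filter, Finset.mem_range, Set.mem_ofPred_eq] at hx hy
    have := congrArg ZMod.val hxy
    simpa [ZMod.val_natCast, Nat.mod_eq_of_lt hx.1, Nat.mod_eq_of_lt hy.1] using this

/-- The weight of the pairs of equally coloured nodes of `V`, counted once for each common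
neighbour. -/
noncomputable def collisions {U : Type u} {V : Type v} [Fintype U] [Fintype V]
    (H : SimpleGraph (U ⊕ V)) (a : U → ℝ) (c : V → ℕ) : ℝ :=
  ∑ x, a x * ∑ y ∈ nbU H x, ∑ y' ∈ nbU H x, if c y = c y' then 1 else 0

/-- The weight of all pairs of nodes of `V`, counted once for each common neighbour. -/
noncomputable def pairWeight {U : Type u} {V : Type v} [Fintype U] [Fintype V]
    (H : SimpleGraph (U ⊕ V)) (a : U → ℝ) : ℝ :=
  ∑ x, a x * ((nbU H x).card : ℝ) ^ 2

theorem sum_nbU_comm {U : Type u} {V : Type v} [Fintype U] [Fintype V] (H : SimpleGraph (U ⊕ V))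
    (F : U → V → ℝ) : ∑ x, ∑ y ∈ nbU H x, F x y = ∑ y, ∑ x ∈ nbV H y, F x y :=
  Finset.sum_comm' (by simp [nbU, nbV])

/-- The weight of the differently coloured pairs at `y` with equal hash values at `ξ`. -/
noncomputable def hashCost {U : Type u} {V : Type v} [Fintype U] [Fintype V]
    (H : SimpleGraph (U ⊕ V)) (a : U → ℝ) (c : V → ℕ) (h : ℕ → ℕ → ℕ) (y : V) (ξ : ℕ) : ℝ :=
  ∑ x ∈ nbV H y, a x * ∑ y' ∈ nbU H x, if c y ≠ c y' ∧ h (c y) ξ = h (c y') ξ then 1 else 0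

/-- The best of p evaluation points is at most the average, and each differently coloured pair
agrees in at most k of them. -/
theorem hashCost_le {U : Type u} {V : Type v} [Fintype U] [Fintype V]
    (H : SimpleGraph (U ⊕ V)) (a : U → ℝ) (ha : ∀ x, 0 ≤ a x) (c : V → ℕ) (h : ℕ → ℕ → ℕ)
    (p k : ℕ) (hp : 0 < p)
    (hh : ∀ y y', c y ≠ c y' →
      ((Finset.range p).filter fun x => h (c y) x = h (c y') x).card ≤ k)
    (y : V) (ξ : ℕ) (hξ : ∀ x < p, hashCost H a c h y ξ ≤ hashCost H a c h y x) :
    hashCost H a c h y ξ ≤ k / p * ∑ x ∈ nbV H y, a x * (nbU H x).card := by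
  have h1 : (p : ℝ) * hashCost H a c h y ξ ≤ ∑ x ∈ Finset.range p, hashCost H a c h y x := by
    have := Finset.card_nsmul_le_sum (Finset.range p) (fun x => hashCost H a c h y x) _
      (fun x hx => hξ x (Finset.mem_range.mp hx))
    simpa using this
  have h2 : ∑ x ∈ Finset.range p, hashCost H a c h y x ≤
      k * ∑ x ∈ nbV H y, a x * (nbU H x).card := by
    simp only [hashCost]
    rw [Finset.sum_comm, Finset.mul_sum]
    refine Finset.sum_le_sum fun x _ => ?_
    rw [← Finset.mul_sum, mul_left_comm]
    refine mul_le_mul_of_nonneg_left ?_ (ha x)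
    rw [Finset.sum_comm, mul_comm, ← nsmul_eq_mul]
    refine Finset.sum_le_card_nsmul _ _ _ fun y' _ => ?_
    by_cases hc : c y = c y'
    · simp [hc]
    · simpa [hc] using hh y y' hc
  rw [div_mul_eq_mul_div, le_div_iff₀ (by exact_mod_cast hp)]
  linarith

/-- The new colour encodes the pair of evaluation point and hash value. A new collision therefore
forces equal evaluation points and is already counted in the cost that y computed from the old
colours alone. This is why all nodes may choose simultaneously. -/
theorem collisions_le_of_hash {U : Type u} {V : Type v} [Fintype U] [Fintype V]
    (H : SimpleGraph (U ⊕ V)) (a : U → ℝ) (ha : ∀ x, 0 ≤ a x) (c : V → ℕ) (h : ℕ → ℕ → ℕ)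
    (p k : ℕ) (hp : 0 < p) (hlt : ∀ c x, h c x < p)
    (hh : ∀ y y', c y ≠ c y' →
      ((Finset.range p).filter fun x => h (c y) x = h (c y') x).card ≤ k)
    (ξ : V → ℕ) (hξ : ∀ y, ∀ x < p, hashCost H a c h y (ξ y) ≤ hashCost H a c h y x) :
    collisions H a (fun y => ξ y * p + h (c y) (ξ y)) ≤
      collisions H a c + k / p * pairWeight H a := by
  have hsplit : ∀ y y', ξ y * p + h (c y) (ξ y) = ξ y' * p + h (c y') (ξ y') →
      ξ y = ξ y' ∧ h (c y) (ξ y) = h (c y') (ξ y') := by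
    intro y y' e
    have e1 := congrArg (· / p) e
    have e2 := congrArg (· % p) e
    simp only [mul_comm _ p, Nat.mul_add_div hp, Nat.mul_add_mod, Nat.div_eq_of_lt (hlt _ _),
      Nat.mod_eq_of_lt (hlt _ _)] at e1 e2
    exact ⟨by simpa using e1, e2⟩
  have h1 : collisions H a (fun y => ξ y * p + h (c y) (ξ y)) ≤
      collisions H a c + ∑ y, hashCost H a c h y (ξ y) := by
    simp only [hashCost]
    rw [← sum_nbU_comm H (fun x y => a x * ∑ y' ∈ nbU H x,
      if c y ≠ c y' ∧ h (c y) (ξ y) = h (c y') (ξ y) then 1 else 0)]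
    simp only [collisions]
    rw [← Finset.sum_add_distrib]
    refine Finset.sum_le_sum fun x _ => ?_
    rw [← Finset.mul_sum, ← mul_add, ← Finset.sum_add_distrib]
    refine mul_le_mul_of_nonneg_left (Finset.sum_le_sum fun y _ => ?_) (ha x)
    rw [← Finset.sum_add_distrib]
    refine Finset.sum_le_sum fun y' _ => ?_
    by_cases e : ξ y * p + h (c y) (ξ y) = ξ y' * p + h (c y') (ξ y')
    · obtain ⟨e1, e2⟩ := hsplit y y' e
      by_cases hc : c y = c y'
      · simp [hc]; split_ifs <;> norm_num
      · rw [if_pos e, if_neg hc, if_pos ⟨hc, by rw [e2, e1]⟩]; norm_num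
    · rw [if_neg e]
      positivity
  refine h1.trans (add_le_add le_rfl ?_)
  calc ∑ y, hashCost H a c h y (ξ y)
      ≤ ∑ y, (k / p : ℝ) * ∑ x ∈ nbV H y, a x * (nbU H x).card :=
        Finset.sum_le_sum fun y _ => hashCost_le H a ha c h p k hp hh y _ (hξ y)
    _ = k / p * pairWeight H a := by
        rw [← Finset.mul_sum, ← sum_nbU_comm H (fun x _ => a x * (nbU H x).card)]
        congr 1
        refine Finset.sum_congr rfl fun x _ => ?_
        rw [Finset.sum_const, nsmul_eq_mul]; ring

/-- `hashCost`, computed from the messages that a node of `V` receives. -/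
noncomputable def localHashCost (h : ℕ → ℕ → ℕ) (c : ℕ) (ms : Multiset (ℝ × Multiset ℕ)) (ξ : ℕ) :
    ℝ :=
  (ms.map fun q => q.1 * (q.2.map fun c' => if c ≠ c' ∧ h c ξ = h c' ξ then (1 : ℝ) else 0).sum).sum

theorem exists_argmin (p : ℕ) (hp : 0 < p) (F : ℕ → ℝ) : ∃ x, x < p ∧ ∀ y < p, F x ≤ F y := by
  obtain ⟨x, hx, h⟩ := Finset.exists_min_image (Finset.range p) F ⟨0, by simpa using hp⟩
  exact ⟨x, by simpa using hx, fun y hy => h y (by simpa using hy)⟩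

/-- One step of colour reduction. -/
theorem Solves.colourStep (p k : ℕ) (hp : p.Prime) :
    Solves 2 (fun (U : Type u) (V : Type v) _ _ H (a : U → ℝ) (c : V → ℕ) (a' : U → ℝ)
        (c' : V → ℕ) =>
      a' = a ∧ ((∀ x, 0 ≤ a x) → (∀ y, c y < p ^ k) →
        (∀ y, c' y < p ^ 2) ∧
        collisions H a c' ≤ collisions H a c + k / p * pairWeight H a)) := by
  obtain ⟨h, hlt, hh⟩ := exists_hash_family p k hp
  choose ξ hξp hξ using fun (c : ℕ) (ms : Multiset (ℝ × Multiset ℕ)) =>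
    exists_argmin p hp.pos (localHashCost h c ms)
  have h1 := Solves.round.{u, v} (fun (x : ℝ) (ms : Multiset ℕ) => (x, ms))
    (fun (c : ℕ) (_ : Multiset ℝ) => c)
  have h2 := Solves.round.{u, v} (fun (q : ℝ × Multiset ℕ) (_ : Multiset ℕ) => q.1)
    (fun (c : ℕ) (ms : Multiset (ℝ × Multiset ℕ)) => ξ c ms * p + h c (ξ c ms))
  refine (h1.comp h2).mono ?_
  rintro U V _ _ H a c _ _ ⟨_, _, ⟨rfl, rfl⟩, rfl, rfl⟩
  refine ⟨rfl, fun ha hc => ⟨fun y => ?_, ?_⟩⟩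
  · have e1 := hξp (c y) ((nbV H y).val.map fun x => (a x, (nbU H x).val.map c))
    have e2 := hlt (c y) (ξ (c y) ((nbV H y).val.map fun x => (a x, (nbU H x).val.map c)))
    nlinarith
  · refine collisions_le_of_hash H a ha c h p k hp.pos hlt
      (fun y y' => hh _ _ (hc y) (hc y')) _ fun y x hx => ?_
    have := hξ (c y) ((nbV H y).val.map fun x => (a x, (nbU H x).val.map c)) x hx
    simp only [localHashCost, Multiset.map_map, Function.comp_def] at this
    exact this

end Colouring

/-! ### Derandomised rounding along colour classes -/

section Rounding

open scoped Classical

/-- The quadratic form that measures the deviation of `z` from `0` on the neighbourhoods. -/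
noncomputable def deviation {U : Type u} {V : Type v} [Fintype U] [Fintype V]
    (H : SimpleGraph (U ⊕ V)) (a : U → ℝ) (z : V → ℝ) : ℝ :=
  ∑ x, a x * (∑ y ∈ nbU H x, z y) ^ 2

/-- The correlation of `y` with the values `z`. -/
noncomputable def correlation {U : Type u} {V : Type v} [Fintype U] [Fintype V]
    (H : SimpleGraph (U ⊕ V)) (a : U → ℝ) (z : V → ℝ) (y : V) : ℝ :=
  ∑ x ∈ nbV H y, a x * ∑ y' ∈ nbU H x, z y'

/-- The value that a node chooses, given its correlation with the earlier values. -/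
noncomputable def roundedValue (δ s : ℝ) : ℝ := if 0 < s then -δ else 1 - δ

theorem roundedValue_mul_nonpos {δ : ℝ} (h0 : 0 ≤ δ) (h1 : δ ≤ 1) (s : ℝ) :
    roundedValue δ s * s ≤ 0 := by
  unfold roundedValue
  split_ifs with h <;> nlinarith

theorem abs_roundedValue_le {δ : ℝ} (h0 : 0 ≤ δ) (h1 : δ ≤ 1) (s : ℝ) : |roundedValue δ s| ≤ 1 := by
  unfold roundedValue
  split_ifs <;> rw [abs_le] <;> constructor <;> linarith

/-- The weight of the pairs of nodes of colour `i`. -/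
noncomputable def collisionsAt {U : Type u} {V : Type v} [Fintype U] [Fintype V]
    (H : SimpleGraph (U ⊕ V)) (a : U → ℝ) (c : V → ℕ) (i : ℕ) : ℝ :=
  ∑ x, a x * ∑ y ∈ nbU H x, ∑ y' ∈ nbU H x, if c y = i ∧ c y' = i then 1 else 0

theorem sum_collisionsAt_le {U : Type u} {V : Type v} [Fintype U] [Fintype V]
    (H : SimpleGraph (U ⊕ V)) (a : U → ℝ) (ha : ∀ x, 0 ≤ a x) (c : V → ℕ) (K : ℕ) :
    ∑ i ∈ Finset.range K, collisionsAt H a c i ≤ collisions H a c := by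
  simp only [collisionsAt, collisions]
  rw [Finset.sum_comm]
  refine Finset.sum_le_sum fun x _ => ?_
  rw [← Finset.mul_sum, Finset.sum_comm]
  refine mul_le_mul_of_nonneg_left (Finset.sum_le_sum fun y _ => ?_) (ha x)
  rw [Finset.sum_comm]
  refine Finset.sum_le_sum fun y' _ => ?_
  by_cases h : c y = c y'
  · simp only [h, and_self, if_true, Finset.sum_ite_eq, Finset.mem_range]
    split_ifs <;> norm_num
  · rw [if_neg h]
    refine (Finset.sum_eq_zero fun i _ => if_neg ?_).le
    rintro ⟨h1, h2⟩
    exact h (h1.trans h2.symm)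

/-- Expand the square: the choice of sign makes the cross term nonpositive, and the new square term
only involves pairs of colour i, with values of modulus at most 1. By `hz` the nodes of colour i
still have the value 0. -/
theorem deviation_update_le {U : Type u} {V : Type v} [Fintype U] [Fintype V]
    (H : SimpleGraph (U ⊕ V)) (a : U → ℝ) (ha : ∀ x, 0 ≤ a x) (c : V → ℕ) {δ : ℝ} (h0 : 0 ≤ δ)
    (h1 : δ ≤ 1) (i : ℕ) (z : V → ℝ) (hz : ∀ y, i ≤ c y → z y = 0) :
    deviation H a (fun y => if c y = i then roundedValue δ (correlation H a z y) else z y) ≤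
      deviation H a z + collisionsAt H a c i := by
  set t : V → ℝ := fun y => if c y = i then roundedValue δ (correlation H a z y) else 0 with ht
  have e : (fun y => if c y = i then roundedValue δ (correlation H a z y) else z y) =
      fun y => z y + t y := by
    funext y
    by_cases h : c y = i
    · simp [ht, h, hz y h.ge]
    · simp [ht, h]
  rw [e]
  have cross : ∑ x, a x * ((∑ y ∈ nbU H x, z y) * ∑ y ∈ nbU H x, t y) ≤ 0 := by
    have : ∑ x, a x * ((∑ y ∈ nbU H x, z y) * ∑ y ∈ nbU H x, t y) =
        ∑ y, t y * correlation H a z y := by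
      simp only [correlation, Finset.mul_sum]
      rw [← sum_nbU_comm H fun x y => ∑ y' ∈ nbU H x, t y * (a x * z y')]
      refine Finset.sum_congr rfl fun x _ => Finset.sum_congr rfl fun y _ => ?_
      rw [← Finset.mul_sum, ← Finset.mul_sum]; ring
    rw [this]
    refine Finset.sum_nonpos fun y _ => ?_
    simp only [ht]
    split_ifs
    · exact roundedValue_mul_nonpos h0 h1 _
    · simp
  have square : deviation H a t ≤ collisionsAt H a c i := by
    refine Finset.sum_le_sum fun x _ => mul_le_mul_of_nonneg_left ?_ (ha x)
    rw [sq, Finset.sum_mul_sum]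
    refine Finset.sum_le_sum fun y _ => Finset.sum_le_sum fun y' _ => ?_
    by_cases h : c y = i
    · by_cases h' : c y' = i
      · simp only [ht, h, h', if_true, and_self]
        refine (le_abs_self _).trans ?_
        rw [abs_mul]
        exact mul_le_one₀ (abs_roundedValue_le h0 h1 _) (abs_nonneg _)
          (abs_roundedValue_le h0 h1 _)
      · simp [ht, h']
    · simp [ht, h]
  have expand : deviation H a (fun y => z y + t y) = deviation H a z + deviation H a t +
      2 * ∑ x, a x * ((∑ y ∈ nbU H x, z y) * ∑ y ∈ nbU H x, t y) := by
    simp only [deviation, Finset.mul_sum (s := (Finset.univ : Finset U))]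
    rw [← Finset.sum_add_distrib, ← Finset.sum_add_distrib]
    refine Finset.sum_congr rfl fun x _ => ?_
    rw [Finset.sum_add_distrib]; ring
  linarith

/-- Given a colouring with `K` colours, round the constant `δ` to values in `{0, 1}`. -/
theorem Solves.rounding (δ : ℝ) (h0 : 0 ≤ δ) (h1 : δ ≤ 1) (K : ℕ) :
    Solves (K * 2) (fun (U : Type u) (V : Type v) _ _ H (a : U → ℝ) (c : V → ℕ)
        (a' : U → ℝ) (b' : V → ℕ × ℝ) =>
      a' = a ∧ (∀ y, (b' y).1 = c y) ∧
        ((∀ y, c y < K → (b' y).2 = -δ ∨ (b' y).2 = 1 - δ) ∧ (∀ y, K ≤ c y → (b' y).2 = 0) ∧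
        ((∀ x, 0 ≤ a x) → deviation H a (fun y => (b' y).2) ≤
          ∑ i ∈ Finset.range K, collisionsAt H a c i))) := by
  induction K with
  | zero =>
    refine ((Solves.map.{u, v} (id : ℝ → ℝ) (fun c : ℕ => (c, (0 : ℝ)))).lift (Nat.zero_le _)).mono ?_
    rintro U V _ _ H a c _ _ ⟨rfl, rfl⟩
    exact ⟨rfl, fun _ => rfl, by simp, by simp, by simp [deviation]⟩
  | succ K ih =>
    have r1 := Solves.round.{u, v} (fun (x : ℝ) (ms : Multiset (ℕ × ℝ)) => (x, (ms.map (·.2)).sum))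
      (fun (b : ℕ × ℝ) (_ : Multiset ℝ) => b)
    have r2 := Solves.round.{u, v} (fun (q : ℝ × ℝ) (_ : Multiset (ℕ × ℝ)) => q.1)
      (fun (b : ℕ × ℝ) (ms : Multiset (ℝ × ℝ)) =>
        (b.1, if b.1 = K then roundedValue δ ((ms.map fun q => q.1 * q.2).sum) else b.2))
    have := (ih.comp (r1.comp r2)).lift (r' := (K + 1) * 2) (by omega)
    refine this.mono ?_
    rintro U V _ _ H a c _ _ ⟨_, b, ⟨rfl, hb, hz, hz0, hd⟩, _, _, ⟨rfl, rfl⟩, rfl, rfl⟩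
    refine ⟨rfl, hb, fun y hy => ?_, fun y hy => ?_, fun ha => ?_⟩
    · by_cases h : (b y).1 = K
      · simp only [h, if_true, roundedValue]
        split_ifs <;> simp
      · simp only [h, if_false]
        exact hz y (by rw [hb] at h; omega)
    · have h : (b y).1 ≠ K := by rw [hb]; omega
      simp only [h, if_false]
      exact hz0 y (by omega)
    · rw [Finset.sum_range_succ]
      refine le_trans ?_ (add_le_add (hd ha) le_rfl)
      refine le_trans (le_of_eq ?_) (deviation_update_le H _ ha c h0 h1 K (fun y => (b y).2) hz0)
      congr 1
      funext y
      simp only [hb, Multiset.map_map, Function.comp_def]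
      rfl

end Rounding

/-! ### Defective colouring in O(log* N) rounds -/

section DefectiveColouring

/-- Iterated powers of two. -/
def tower : ℕ → ℕ
  | 0 => 1
  | k + 1 => 2 ^ tower k

theorem lt_tower (k : ℕ) : k < tower k := by
  induction k with
  | zero => simp [tower]
  | succ k ih => exact lt_of_le_of_lt ih Nat.lt_two_pow_self

theorem le_tower (k : ℕ) : ∀ x : ℝ, (Real.logb 2)^[k] x ≤ 1 → x ≤ tower k := by
  induction k with
  | zero => intro x h; simpa [tower] using h
  | succ k ih =>
    intro x h
    rw [Function.iterate_succ_apply] at h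
    rcases le_or_gt x 0 with h0 | h0
    · exact h0.trans (Nat.cast_nonneg _)
    · have := (Real.logb_le_iff_le_rpow (by norm_num) h0).mp (ih _ h)
      rw [Real.rpow_natCast] at this
      simpa [tower] using this

theorem le_tower_logStar (N : ℕ) : N ≤ tower (logStar N) := by
  exact_mod_cast le_tower _ _ (logStar_spec N)

theorem exists_prime_between (n : ℕ) (hn : 0 < n) : ∃ p, p.Prime ∧ n < p ∧ p ≤ 2 * n :=
  Nat.exists_prime_lt_and_le_two_mul n hn.ne'

theorem pairWeight_nonneg {U : Type u} {V : Type v} [Fintype U] [Fintype V]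
    (H : SimpleGraph (U ⊕ V)) (a : U → ℝ) (ha : ∀ x, 0 ≤ a x) : 0 ≤ pairWeight H a :=
  Finset.sum_nonneg fun x _ => mul_nonneg (ha x) (sq_nonneg _)

/-- A colour reduction step with the number of collisions made explicit. -/
theorem Solves.colourStep_of_le (B ℓ m : ℕ) (hB : 0 < B) (hℓ : 0 < ℓ) (hm : 0 < m) :
    Solves 2 (fun (U : Type u) (V : Type v) _ _ H (a : U → ℝ) (c : V → ℕ) (a' : U → ℝ)
        (c' : V → ℕ) =>
      a' = a ∧ ((∀ x, 0 ≤ a x) → (∀ y, c y < 2 ^ ℓ) →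
        (∀ y, c' y < (2 * (ℓ * (B * m))) ^ 2) ∧
        collisions H a c' ≤ collisions H a c + 1 / (B * m) * pairWeight H a)) := by
  obtain ⟨p, hp, hp1, hp2⟩ := exists_prime_between (ℓ * (B * m)) (by positivity)
  refine (Solves.colourStep.{u, v} p ℓ hp).mono ?_
  rintro U V _ _ H a c a' c' ⟨h1, h2⟩
  refine ⟨h1, fun ha hc => ?_⟩
  obtain ⟨h3, h4⟩ := h2 ha fun y => (hc y).trans_le (Nat.pow_le_pow_left hp.two_le _)
  refine ⟨fun y => (h3 y).trans_le (Nat.pow_le_pow_left hp2 _), h4.trans ?_⟩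
  have : (ℓ : ℝ) / p ≤ 1 / (B * m) := by
    rw [div_le_div_iff₀ (by exact_mod_cast hp.pos) (by positivity), one_mul]
    exact_mod_cast hp1.le
  have := mul_le_mul_of_nonneg_right this (pairWeight_nonneg H a ha)
  linarith

/-- One step takes the number of colours from level k + 1 of the tower to level k. The exponent on
the left is 2(6 + 2B + `tower k` + k + 1), and k + 1 ≤ `tower k`. -/
theorem colour_bound (B k : ℕ) (hB : 0 < B) :
    (2 * (32 * B * tower (k + 1) * (B * 2 ^ (k + 1)))) ^ 2 ≤ 2 ^ (32 * B * tower k) := by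
  have h1 : 2 * (32 * B * tower (k + 1) * (B * 2 ^ (k + 1))) ≤
      2 ^ (6 + 2 * B + tower k + (k + 1)) := by
    have : B ≤ 2 ^ B := Nat.lt_two_pow_self.le
    calc 2 * (32 * B * tower (k + 1) * (B * 2 ^ (k + 1)))
        = 64 * (B * B) * 2 ^ tower k * 2 ^ (k + 1) := by simp only [tower]; ring
      _ ≤ 64 * (2 ^ B * 2 ^ B) * 2 ^ tower k * 2 ^ (k + 1) := by gcongr
      _ = _ := by ring
  have h2 := lt_tower k
  calc _ ≤ (2 ^ (6 + 2 * B + tower k + (k + 1))) ^ 2 := Nat.pow_le_pow_left h1 _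
    _ = 2 ^ ((6 + 2 * B + tower k + (k + 1)) * 2) := by rw [pow_mul]
    _ ≤ _ := Nat.pow_le_pow_right (by norm_num) (by nlinarith)

theorem Solves.reduceColours (B : ℕ) (hB : 0 < B) (k : ℕ) :
    Solves (2 * k) (fun (U : Type u) (V : Type v) _ _ H (a : U → ℝ) (c : V → ℕ) (a' : U → ℝ)
        (c' : V → ℕ) =>
      a' = a ∧ ((∀ x, 0 ≤ a x) → (∀ y, c y < 2 ^ (32 * B * tower k)) →
        (∀ y, c' y < 2 ^ (32 * B)) ∧
        collisions H a c' ≤ collisions H a c + (1 - (1 / 2) ^ k) / B * pairWeight H a)) := by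
  induction k with
  | zero =>
    refine (Solves.map.{u, v} (id : ℝ → ℝ) (id : ℕ → ℕ)).mono ?_
    rintro U V _ _ H a c _ _ ⟨rfl, rfl⟩
    exact ⟨rfl, fun _ hc => ⟨by simpa [tower] using hc, by simp⟩⟩
  | succ k ih =>
    -- The step at level k + 1 may cost 1/(B·2^(k+1)), so that all costs form a geometric series
    -- with sum below 1/B.
    have h1 := Solves.colourStep_of_le.{u, v} B (32 * B * tower (k + 1)) (2 ^ (k + 1)) hB
      (Nat.mul_pos (by omega) (by have := lt_tower (k + 1); omega)) (by positivity)
    refine ((h1.comp ih).lift (by omega)).mono ?_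
    rintro U V _ _ H _ c a c'' ⟨_, c', ⟨rfl, h2⟩, rfl, h3⟩
    refine ⟨rfl, fun ha hc => ?_⟩
    obtain ⟨h4, h5⟩ := h2 ha hc
    obtain ⟨h6, h7⟩ := h3 ha fun y => (h4 y).trans_le (colour_bound B k hB)
    refine ⟨h6, ?_⟩
    have e : (1 - (1 / 2 : ℝ) ^ (k + 1)) / B =
        (1 - (1 / 2) ^ k) / B + 1 / (B * (2 ^ (k + 1) : ℕ)) := by
      have : (B : ℝ) ≠ 0 := by positivity
      simp only [one_div, inv_pow]
      push_cast
      field_simp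
      ring
    rw [e, add_mul]
    linarith

/-- A colouring with a bounded number of colours and few collisions. -/
theorem Solves.defectiveColouring (B N : ℕ) (hB : 0 < B) :
    Solves (2 * logStar N + 2) (fun (U : Type u) (V : Type v) _ _ H (a : U → ℝ) (c : V → ℕ)
        (a' : U → ℝ) (c' : V → ℕ) =>
      a' = a ∧ ((∀ x, 0 ≤ a x) → (∀ y, c y ≤ N) → (∀ y, c' y < 4096 * B ^ 4) ∧
        collisions H a c' ≤ collisions H a c + 2 / B * pairWeight H a)) := by
  have h := (Solves.reduceColours.{u, v} B hB (logStar N)).comp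
    (Solves.colourStep_of_le.{u, v} B (32 * B) 1 hB (by omega) one_pos)
  refine h.mono ?_
  rintro U V _ _ H _ c a c'' ⟨_, c', ⟨rfl, h2⟩, rfl, h3⟩
  refine ⟨rfl, fun ha hc => ?_⟩
  obtain ⟨h4, h5⟩ := h2 ha fun y => by
    have h1 : tower (logStar N) < 2 ^ tower (logStar N) := Nat.lt_two_pow_self
    have h2 : (2 : ℕ) ^ tower (logStar N) ≤ 2 ^ (32 * B * tower (logStar N)) :=
      Nat.pow_le_pow_right (by norm_num) (Nat.le_mul_of_pos_left _ (by omega))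
    have := hc y
    have := le_tower_logStar N
    omega
  obtain ⟨h6, h7⟩ := h3 ha h4
  refine ⟨fun y => (h6 y).trans_le (le_of_eq (by ring)), h7.trans ?_⟩
  have hP := pairWeight_nonneg H a ha
  have hs : (1 - (1 / 2 : ℝ) ^ logStar N) / B * pairWeight H a ≤ 1 / B * pairWeight H a := by
    gcongr
    have : (0 : ℝ) ≤ (1 / 2) ^ logStar N := by positivity
    linarith
  have e : 2 / (B : ℝ) * pairWeight H a = 1 / B * pairWeight H a + 1 / B * pairWeight H a := by
    ring
  rw [e]
  simp only [Nat.cast_one, mul_one] at h7 ⊢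
  linarith

end DefectiveColouring

/-! ### One sampling step and its repetition -/

section Sampling

open scoped Classical

/-- The number of neighbours in `K` of a node of `U`. -/
noncomputable def degIn {U : Type u} {V : Type v} [Fintype V] (H : SimpleGraph (U ⊕ V)) (x : U)
    (K : V → Prop) : ℕ := ((nbU H x).filter K).card

theorem degIn_le {U : Type u} {V : Type v} [Fintype V] (H : SimpleGraph (U ⊕ V)) (x : U)
    (K : V → Prop) : degIn H x K ≤ (nbU H x).card := Finset.card_filter_le _ _

theorem degIn_restrictGraph {U : Type u} {V : Type v} [Fintype V] (H : SimpleGraph (U ⊕ V)) (x : U)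
    (K K' : V → Prop) : degIn (restrictGraph H K) x K' = degIn H x fun y => K y ∧ K' y := by
  simp only [degIn, nbU_restrictGraph, Finset.filter_filter]
  congr

theorem card_nbU_restrictGraph {U : Type u} {V : Type v} [Fintype V] (H : SimpleGraph (U ⊕ V))
    (x : U) (K : V → Prop) : (nbU (restrictGraph H K) x).card = degIn H x K := by
  simp only [degIn, nbU_restrictGraph]

/-- Chebyshev's inequality: with weights divided by d², every failing node contributes at least ε²
w(x) to the potential. -/
theorem sum_ite_weight_le_deviation {U : Type u} {V : Type v} [Fintype U] [Fintype V]
    (H : SimpleGraph (U ⊕ V)) (w : U → ℝ) (hw : ∀ x, 0 ≤ w x) (z : V → ℝ) (θ : ℕ) (hθ : 0 < θ)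
    {ε : ℝ} (hε : 0 < ε) :
    ε ^ 2 * ∑ x, (if θ ≤ (nbU H x).card ∧ ε * (nbU H x).card < |∑ y ∈ nbU H x, z y|
      then w x else 0) ≤
    deviation H (fun x => if θ ≤ (nbU H x).card then w x / ((nbU H x).card : ℝ) ^ 2 else 0) z := by
  rw [Finset.mul_sum]
  refine Finset.sum_le_sum fun x _ => ?_
  dsimp only
  by_cases h1 : θ ≤ (nbU H x).card
  · have hd : (0 : ℝ) < (nbU H x).card := by exact_mod_cast hθ.trans_le h1
    rw [if_pos h1]
    split_ifs with h
    · have h2 : (ε * (nbU H x).card) ^ 2 ≤ (∑ y ∈ nbU H x, z y) ^ 2 := by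
        rw [← sq_abs (∑ y ∈ nbU H x, z y)]
        exact pow_le_pow_left₀ (by positivity) h.2.le 2
      rw [div_mul_eq_mul_div, le_div_iff₀ (by positivity)]
      nlinarith [mul_le_mul_of_nonneg_left h2 (hw x)]
    · have := hw x
      rw [mul_zero]
      positivity
  · simp [h1]

theorem pairWeight_normalized_le {U : Type u} {V : Type v} [Fintype U] [Fintype V]
    (H : SimpleGraph (U ⊕ V)) (w : U → ℝ) (hw : ∀ x, 0 ≤ w x) (θ : ℕ) :
    pairWeight H (fun x => if θ ≤ (nbU H x).card then w x / ((nbU H x).card : ℝ) ^ 2 else 0) ≤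
      ∑ x, w x := by
  refine Finset.sum_le_sum fun x _ => ?_
  dsimp only
  split_ifs with h1
  · rcases eq_or_ne ((nbU H x).card : ℝ) 0 with h | h
    · simpa [h] using hw x
    · rw [div_mul_cancel₀ _ (pow_ne_zero 2 h)]
  · simpa using hw x

/-- Injective identifiers collide only on the diagonal, giving d pairs out of d², hence a fraction
of at most 1/θ. -/
theorem collisions_normalized_le {U : Type u} {V : Type v} [Fintype U] [Fintype V]
    (H : SimpleGraph (U ⊕ V)) (w : U → ℝ) (hw : ∀ x, 0 ≤ w x) (θ : ℕ) (hθ : 0 < θ)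
    (ident : V → ℕ) (hi : Function.Injective ident) :
    collisions H (fun x => if θ ≤ (nbU H x).card then w x / ((nbU H x).card : ℝ) ^ 2 else 0)
      ident ≤ 1 / θ * ∑ x, w x := by
  rw [Finset.mul_sum]
  refine Finset.sum_le_sum fun x _ => ?_
  have hθ' : (0 : ℝ) < θ := by exact_mod_cast hθ
  have e : (∑ y ∈ nbU H x, ∑ y' ∈ nbU H x, if ident y = ident y' then (1 : ℝ) else 0) =
      (nbU H x).card := by
    simp [hi.eq_iff]
  rw [e]
  dsimp only
  split_ifs with h1
  · have h2 : (θ : ℝ) ≤ (nbU H x).card := by exact_mod_cast h1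
    have hd : (0 : ℝ) < (nbU H x).card := hθ'.trans_le h2
    have : w x / ((nbU H x).card : ℝ) ^ 2 * (nbU H x).card = 1 / (nbU H x).card * w x := by
      field_simp
    rw [this]
    exact mul_le_mul_of_nonneg_right (one_div_le_one_div_of_le hθ' h2) (hw x)
  · have := hw x
    rw [zero_mul]
    positivity

theorem sum_rounded_eq {V : Type v} (s : Finset V) (z : V → ℝ) (δ : ℝ)
    (hz : ∀ y, z y = -δ ∨ z y = 1 - δ) :
    ∑ y ∈ s, z y = (1 - δ) * s.card - (s.filter fun y => z y = -δ).card := by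
  have : ∀ y, z y = (1 - δ) - if z y = -δ then 1 else 0 := by
    intro y
    rcases hz y with h | h
    · rw [if_pos h, h]; ring
    · rw [if_neg (by rw [h]; intro h'; linarith), h]; ring
  rw [Finset.sum_congr rfl fun y _ => this y, Finset.sum_sub_distrib, Finset.sum_const,
    nsmul_eq_mul, Finset.sum_boole]
  ring

/-- The number of rounds of one sampling step. -/
noncomputable def stepRounds (B N : ℕ) : ℕ := 1 + (2 * logStar N + 2) + 4096 * B ^ 4 * 2 + 1

/-- Remove about a `δ` fraction of the neighbours of most nodes of degree at least `θ`. -/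
theorem Solves.sampleStep (B N θ : ℕ) (hB : 0 < B) (hθ : 0 < θ) (δ ε : ℝ) (h0 : 0 ≤ δ)
    (h1 : δ ≤ 1) (hε : 0 < ε) :
    Solves (stepRounds B N) (fun (U : Type u) (V : Type v) _ _ H (w : U → ℝ) (ident : V → ℕ)
        (fail : U → Prop) (keep : V → Prop) =>
      (∀ x, 0 ≤ w x) → Function.Injective ident → (∀ y, ident y ≤ N) →
        (∀ x, ¬ fail x → θ ≤ (nbU H x).card →
          |(1 - δ) * (nbU H x).card - degIn H x keep| ≤ ε * (nbU H x).card) ∧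
        ∑ x, (if fail x then w x else 0) ≤ (1 / θ + 2 / B) / ε ^ 2 * ∑ x, w x) := by
  have s1 := Solves.round.{u, v} (fun (x : ℝ) (ms : Multiset ℕ) =>
    if θ ≤ ms.card then x / (ms.card : ℝ) ^ 2 else 0) (fun (c : ℕ) (_ : Multiset ℝ) => c)
  have s2 := Solves.defectiveColouring.{u, v} B N hB
  have s3 := Solves.rounding.{u, v} δ h0 h1 (4096 * B ^ 4)
  have s4 := Solves.round.{u, v} (fun (_ : ℝ) (ms : Multiset (ℕ × ℝ)) =>
    θ ≤ ms.card ∧ ε * ms.card < |(ms.map fun q => q.2).sum|)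
    -- The value −δ means kept, so the sum of z over a neighbourhood is (1 − δ)d minus the number of
    -- kept neighbours.
    (fun (b : ℕ × ℝ) (_ : Multiset ℝ) => b.2 = -δ)
  refine (((s1.comp s2).comp s3).comp s4).mono ?_
  rintro U V _ _ H w ident fail keep ⟨a, b, ⟨a, c, ⟨_, _, ⟨rfl, rfl⟩, rfl, hc⟩, rfl, -, hz, -, hd⟩,
    rfl, rfl⟩ hw hi hN
  simp only [Multiset.card_map, Finset.card_val, Multiset.map_map, Function.comp_def] at hc hd ⊢
  have ha : ∀ x, 0 ≤ (fun x => if θ ≤ (nbU H x).card then w x / ((nbU H x).card : ℝ) ^ 2 else 0) x := by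
    intro x
    have := hw x
    positivity
  obtain ⟨hc1, hc2⟩ := hc ha hN
  have hz' : ∀ y, (b y).2 = -δ ∨ (b y).2 = 1 - δ := fun y => hz y (hc1 y)
  refine ⟨fun x hx hθx => ?_, ?_⟩
  · rw [degIn, ← sum_rounded_eq (nbU H x) (fun y => (b y).2) δ hz']
    by_contra h
    exact hx ⟨hθx, not_le.mp h⟩
  · have e1 := sum_ite_weight_le_deviation H w hw (fun y => (b y).2) θ hθ hε
    have e2 := (hd ha).trans (sum_collisionsAt_le H _ ha c _)
    have e3 := collisions_normalized_le H w hw θ hθ ident hi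
    have e4 := pairWeight_normalized_le H w hw θ
    have e5 : 2 / (B : ℝ) * pairWeight H (fun x => if θ ≤ (nbU H x).card then
        w x / ((nbU H x).card : ℝ) ^ 2 else 0) ≤ 2 / B * ∑ x, w x := by gcongr
    rw [div_mul_eq_mul_div, le_div_iff₀ (by positivity), mul_comm, add_mul]
    exact e1.trans (by linarith)

-- Failures are controlled in a combined normalised weight w; this extracts the bound for each
-- importance f. If I = 0, then division by I is meaningless but f vanishes.
theorem sum_fail_le {U : Type u} [Fintype U] (w f : U → ℝ) (fail : U → Prop) (I q : ℝ)
    (hf : ∀ x, 0 ≤ f x) (hI : ∑ x, f x ≤ I) (hw : ∀ x, f x / I ≤ w x)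
    (hq : ∑ x, (if fail x then w x else 0) ≤ q) : ∑ x, (if fail x then f x else 0) ≤ q * I := by
  have hI0 : 0 ≤ I := (Finset.sum_nonneg fun x _ => hf x).trans hI
  rcases hI0.eq_or_lt with h | h
  · subst h
    have : ∀ x, f x = 0 := fun x =>
      (Finset.sum_eq_zero_iff_of_nonneg fun x _ => hf x).mp
        (le_antisymm hI (Finset.sum_nonneg fun x _ => hf x)) x (Finset.mem_univ x)
    simp [this]
  · refine le_trans ?_ (mul_le_mul_of_nonneg_right hq h.le)
    rw [Finset.sum_mul]
    refine Finset.sum_le_sum fun x _ => ?_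
    split_ifs
    · exact (div_le_iff₀ h).mp (hw x)
    · simp

/-- Repeat the sampling step `m` times. -/
theorem Solves.sampleSteps (B N θ : ℕ) (hB : 0 < B) (hθ : 0 < θ) (δ ε ρ q : ℝ) (h0 : 0 ≤ δ)
    (h1 : δ + ε ≤ 1) (hε : 0 < ε) (hεδ : ε ≤ δ) (hρ1 : 1 ≤ ρ) (hρ : 1 ≤ (1 - δ + ε) * ρ)
    (hq : (1 / θ + 2 / B) / ε ^ 2 ≤ q) (m : ℕ) (IL IU : ℝ) :
    Solves (m * stepRounds B N) (fun (U : Type u) (V : Type v) _ _ H (imp : U → ℝ × ℝ)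
        (ident : V → ℕ) (bad : U → ℕ) (keep : V → Prop) =>
      (∀ x, 0 ≤ (imp x).1) → (∀ x, 0 ≤ (imp x).2) →
      Function.Injective ident → (∀ y, ident y ≤ N) →
      ∑ x, (imp x).1 ≤ IL → ∑ x, (imp x).2 ≤ IU →
        ∑ x, (imp x).2 * 2 ^ bad x ≤ (1 + 2 * q) ^ m * IU ∧
        ∑ x, (if bad x = 0 then 0 else (imp x).1) ≤ m * (2 * q * IL) ∧
        (∀ x, degIn H x keep < θ ∨
          (degIn H x keep : ℝ) ≤
            (1 - δ + ε) ^ m * ρ ^ bad x * (nbU H x).card) ∧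
        ∀ x, bad x = 0 → θ ≤ (1 - δ - ε) ^ m * (nbU H x).card →
          (1 - δ - ε) ^ m * (nbU H x).card ≤ degIn H x keep) := by
  have hq0 : 0 ≤ q := le_trans (by positivity) hq
  induction m generalizing IU with
  | zero =>
    refine ((Solves.map.{u, v} (fun _ : ℝ × ℝ => 0) (fun _ : ℕ => True)).lift (Nat.zero_le _)).mono ?_
    rintro U V _ _ H imp ident _ _ ⟨rfl, rfl⟩ - - - - - hU
    refine ⟨by simpa using hU, by simp, fun x => Or.inr (by simp [degIn]), by simp [degIn]⟩
  | succ m ih =>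
    -- Normalising by the budgets gives total weight at most 2, so a single sampling handles both
    -- importances at the price of a factor 2.
    have s1 := (Solves.sampleStep.{u, v} B N θ hB hθ δ ε h0 (by linarith) hε).premap
      (fun p : ℝ × ℝ => p.1 / IL + p.2 / IU) (id : ℕ → ℕ)
    have s2 := (ih ((1 + 2 * q) * IU)).restrict
    have s3 := s1.bind (fun p fail => (p.1, if fail then p.2 * 2 else p.2))
      (fun i keep => (i, keep)) s2 (fun _ (fail : Prop) (bad : ℕ) => (if fail then 1 else 0) + bad)
      (fun _ keep keep' => keep ∧ keep')
    refine (s3.lift (by rw [Nat.succ_mul, Nat.add_comm])).mono ?_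
    rintro U V _ _ H imp ident _ _ ⟨fail, keep, bad, keep', hs, hr, rfl, rfl⟩ hL0 hU0 hi hN hL hU
    have hIL : 0 ≤ IL := (Finset.sum_nonneg fun x _ => hL0 x).trans hL
    have hIU : 0 ≤ IU := (Finset.sum_nonneg fun x _ => hU0 x).trans hU
    have hw0 : ∀ x, 0 ≤ (imp x).1 / IL := fun x => div_nonneg (hL0 x) hIL
    have hw1 : ∀ x, 0 ≤ (imp x).2 / IU := fun x => div_nonneg (hU0 x) hIU
    obtain ⟨hs1, hs2⟩ := hs (fun x => add_nonneg (hw0 x) (hw1 x)) hi hN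
    have hfail : ∑ x, (if fail x then (imp x).1 / IL + (imp x).2 / IU else 0) ≤ 2 * q := by
      have e : ∑ x, ((imp x).1 / IL + (imp x).2 / IU) ≤ 2 := by
        rw [Finset.sum_add_distrib, ← Finset.sum_div, ← Finset.sum_div]
        linarith [div_le_one_of_le₀ hL hIL, div_le_one_of_le₀ hU hIU]
      have e0 : 0 ≤ ∑ x, ((imp x).1 / IL + (imp x).2 / IU) :=
        Finset.sum_nonneg fun x _ => add_nonneg (hw0 x) (hw1 x)
      nlinarith [mul_le_mul_of_nonneg_right hq e0]
    have hfL := sum_fail_le _ _ fail IL _ hL0 hL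
      (fun x => le_add_of_nonneg_right (hw1 x)) hfail
    have hfU := sum_fail_le _ _ fail IU _ hU0 hU
      (fun x => le_add_of_nonneg_left (hw0 x)) hfail
    simp only [degIn_restrictGraph, card_nbU_restrictGraph] at hr
    obtain ⟨hr1, hr2, hr3, hr4⟩ := hr hL0
      (fun x => by have := hU0 x; split_ifs <;> positivity) hi hN hL (by
        have : ∀ x, (if fail x then (imp x).2 * 2 else (imp x).2) =
            (imp x).2 + if fail x then (imp x).2 else 0 := fun x => by split_ifs <;> ring
        simp only [this]
        rw [Finset.sum_add_distrib]; linarith)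
    refine ⟨?_, ?_, fun x => ?_, fun x hx hd => ?_⟩
    · refine le_trans (le_of_eq ?_) (hr1.trans (le_of_eq (by ring)))
      refine Finset.sum_congr rfl fun x _ => ?_
      dsimp only
      split_ifs
      · ring
      · rw [zero_add]
    · have : ∑ x, (if (if fail x then 1 else 0) + bad x = 0 then 0 else (imp x).1) ≤
          ∑ x, (if fail x then (imp x).1 else 0) + ∑ x, (if bad x = 0 then 0 else (imp x).1) := by
        rw [← Finset.sum_add_distrib]
        refine Finset.sum_le_sum fun x _ => ?_
        have := hL0 x
        by_cases h : fail x <;> by_cases h' : bad x = 0 <;> simp [h, h', this]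
      push_cast
      linarith
    · rcases hr3 x with h | h
      · exact Or.inl h
      · by_cases hdx : (nbU H x).card < θ
        · exact Or.inl ((degIn_le _ _ _).trans_lt hdx)
        · right
          have hr0 : 0 ≤ 1 - δ + ε := by linarith
          -- A failed step may remove nothing; `hρ` says that one factor ρ compensates for this.
          have hk : (degIn H x keep : ℝ) ≤
              (1 - δ + ε) * ρ ^ (if fail x then 1 else 0) * (nbU H x).card := by
            by_cases hf : fail x
            · rw [if_pos hf, pow_one]
              have : (degIn H x keep : ℝ) ≤ (nbU H x).card := by
                exact_mod_cast degIn_le H x keep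
              exact this.trans (le_mul_of_one_le_left (Nat.cast_nonneg _) hρ)
            · have := (abs_le.mp (hs1 x hf (not_lt.mp hdx))).1
              rw [if_neg hf, pow_zero]
              linarith
          calc _ ≤ (1 - δ + ε) ^ m * ρ ^ bad x * degIn H x keep := h
            _ ≤ (1 - δ + ε) ^ m * ρ ^ bad x *
                ((1 - δ + ε) * ρ ^ (if fail x then 1 else 0) * (nbU H x).card) := by gcongr
            _ = (1 - δ + ε) ^ (m + 1) * ρ ^ ((if fail x then 1 else 0) + bad x) *
                (nbU H x).card := by rw [pow_succ, pow_add]; ring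
    · have hf : ¬ fail x := fun h => by simp [h] at hx
      have hb : bad x = 0 := by simpa [hf] using hx
      have hs0 : 0 ≤ 1 - δ - ε := by linarith
      have hle : (1 - δ - ε) ^ (m + 1) * ((nbU H x).card : ℝ) ≤ (nbU H x).card :=
        mul_le_of_le_one_left (Nat.cast_nonneg _) (pow_le_one₀ hs0 (by linarith))
      -- The final target is at least θ, so the degree stays above the threshold at all earlier
      -- steps.
      have hθd : θ ≤ (nbU H x).card := by exact_mod_cast hd.trans hle
      have hk := (abs_le.mp (hs1 x hf hθd)).2
      have hk' : (1 - δ - ε) ^ (m + 1) * ((nbU H x).card : ℝ) ≤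
          (1 - δ - ε) ^ m * degIn H x keep := by
        rw [pow_succ, mul_assoc]
        refine mul_le_mul_of_nonneg_left (by linarith) (pow_nonneg hs0 m)
      exact hk'.trans (hr4 x hb (hd.trans hk'))

end Sampling

/-! ### Sampling at rate e^(−T): choice of parameters -/

section Outer

open scoped Classical

theorem two_hundred_mul_pow_le_exp (T : ℕ) (hT : 10 ≤ T) :
    (200 : ℝ) * (T : ℝ) ^ 9 ≤ Real.exp (15 * T) := by
  have hT' : (10 : ℝ) ≤ T := by exact_mod_cast hT
  have h1 : (T : ℝ) ≤ Real.exp T := by linarith [Real.add_one_le_exp (T : ℝ)]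
  have h2 : (T : ℝ) ^ 9 ≤ Real.exp (9 * T) := by
    calc (T : ℝ) ^ 9 ≤ Real.exp T ^ 9 := pow_le_pow_left₀ (by linarith) h1 9
      _ = _ := by rw [← Real.exp_nat_mul]; norm_num
  have h3 : (200 : ℝ) ≤ Real.exp (6 * T) := by
    calc (200 : ℝ) ≤ (T : ℝ) ^ 6 := by
          have := pow_le_pow_left₀ (by norm_num) hT' 6; norm_num at this; linarith
      _ ≤ Real.exp T ^ 6 := pow_le_pow_left₀ (by linarith) h1 6
      _ = _ := by rw [← Real.exp_nat_mul]; norm_num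
  calc _ ≤ Real.exp (6 * T) * Real.exp (9 * T) := by gcongr
    _ = _ := by rw [← Real.exp_add]; ring_nf

theorem sampling_upper_factor (T : ℝ) (hT : 10 ≤ T) (m : ℕ) (hm : (m : ℝ) = T ^ 3) :
    (1 - 1 / T ^ 2 + 1 / (4 * T ^ 3)) ^ m ≤ Real.exp (-(T - 1)) := by
  have h0 : (0 : ℝ) < T := by linarith
  have hδ : 1 / T ^ 2 ≤ 1 := by
    rw [div_le_one (by positivity)]; nlinarith
  have h1 : 1 - 1 / T ^ 2 + 1 / (4 * T ^ 3) ≤ Real.exp (-(1 / T ^ 2) + 1 / (4 * T ^ 3)) := by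
    linarith [Real.add_one_le_exp (-(1 / T ^ 2) + 1 / (4 * T ^ 3))]
  refine (pow_le_pow_left₀ ?_ h1 m).trans ?_
  · have : 0 ≤ 1 / (4 * T ^ 3) := by positivity
    linarith
  · rw [← Real.exp_nat_mul, hm, Real.exp_le_exp]
    have : T ^ 3 * (-(1 / T ^ 2) + 1 / (4 * T ^ 3)) = -T + 1 / 4 := by field_simp
    linarith

/-- Use 1 − η ≥ e^(−η/(1−η)). As T³η = T + 1/4, the claim reduces to (T + 1)η ≤ 3/4. -/
theorem sampling_lower_factor (T : ℝ) (hT : 10 ≤ T) (m : ℕ) (hm : (m : ℝ) = T ^ 3) :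
    Real.exp (-(T + 1)) ≤ (1 - 1 / T ^ 2 - 1 / (4 * T ^ 3)) ^ m := by
  have h0 : (0 : ℝ) < T := by linarith
  set η := 1 / T ^ 2 + 1 / (4 * T ^ 3) with hη
  have e : 1 - 1 / T ^ 2 - 1 / (4 * T ^ 3) = 1 - η := by rw [hη]; ring
  have hmη : T ^ 3 * η = T + 1 / 4 := by rw [hη]; field_simp
  have hTη : (T + 1) * η ≤ 3 / 4 := by
    have h1 : T ^ 2 * ((T + 1) * η) ≤ T ^ 2 * (3 / 4) := by
      have : T ^ 3 * ((T + 1) * η) ≤ T ^ 3 * (3 / 4) := by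
        calc T ^ 3 * ((T + 1) * η) = (T + 1) * (T ^ 3 * η) := by ring
          _ = (T + 1) * (T + 1 / 4) := by rw [hmη]
          _ ≤ T ^ 3 * (3 / 4) := by nlinarith [sq_nonneg T, mul_pos h0 h0]
      have h2 : T * (T ^ 2 * ((T + 1) * η)) ≤ T * (T ^ 2 * (3 / 4)) := by linarith
      exact le_of_mul_le_mul_left h2 h0
    exact le_of_mul_le_mul_left h1 (by positivity)
  have hη0 : 0 < η := by positivity
  have hη1 : η < 1 := by nlinarith
  have h1 : Real.exp (-(η / (1 - η))) ≤ 1 - η := by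
    rw [Real.exp_neg, inv_le_comm₀ (Real.exp_pos _) (by linarith)]
    have : (1 - η)⁻¹ = η / (1 - η) + 1 := by
      have : 1 - η ≠ 0 := by linarith
      field_simp; ring
    rw [this]
    exact Real.add_one_le_exp _
  rw [e]
  refine le_trans ?_ (pow_le_pow_left₀ (Real.exp_pos _).le h1 m)
  rw [← Real.exp_nat_mul, hm, Real.exp_le_exp]
  have : T ^ 3 * (η / (1 - η)) ≤ T + 1 := by
    rw [← mul_div_assoc, hmη, div_le_iff₀ (by linarith)]
    linarith
  linarith

/-- The number of rounds of the sampling with rate `exp (-T)`. -/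
noncomputable def innerRounds (T N : ℕ) : ℕ := T ^ 3 * stepRounds (200 * T ^ 9) N

/-- Sample the nodes of `V` with rate about `exp (-T)`. -/
theorem Solves.inner (T N : ℕ) (hT : 10 ≤ T) (IL IU : ℝ) :
    Solves (innerRounds T N) (fun (U : Type u) (V : Type v) _ _ H (imp : U → ℝ × ℝ)
        (ident : V → ℕ) (bad : U → ℕ) (keep : V → Prop) =>
      (∀ x, 0 ≤ (imp x).1) → (∀ x, 0 ≤ (imp x).2) →
      Function.Injective ident → (∀ y, ident y ≤ N) →
      ∑ x, (imp x).1 ≤ IL → ∑ x, (imp x).2 ≤ IU →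
        ∑ x, (imp x).2 * 2 ^ bad x ≤ 10 * IU ∧
        ∑ x, (if bad x = 0 then 0 else (imp x).1) ≤ 0.9 * IL ∧
        (∀ x, (degIn H x keep : ℝ) ≤
          max (Real.exp (-((T : ℝ) - 1) + bad x / (T : ℝ) ^ 2) * (nbU H x).card)
            (Real.exp (100 * T))) ∧
        ∀ x, bad x = 0 → Real.exp (100 * T) ≤ (nbU H x).card →
          Real.exp (-((T : ℝ) + 1)) * (nbU H x).card ≤ degIn H x keep) := by
  have hT' : (10 : ℝ) ≤ T := by exact_mod_cast hT
  have h0 : (0 : ℝ) < T := by linarith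
  have hm : ((T ^ 3 : ℕ) : ℝ) = (T : ℝ) ^ 3 := by push_cast; rfl
  have hθ : 0 < 200 * T ^ 9 := by positivity
  have hεδ : 1 / (4 * (T : ℝ) ^ 3) ≤ 1 / (T : ℝ) ^ 2 :=
    one_div_le_one_div_of_le (by positivity) (by nlinarith [sq_nonneg (T : ℝ), pow_pos h0 2])
  -- This gives (1 − δ + ε)e^δ ≥ (1 − δ + ε)(1 + δ) ≥ 1, as required of ρ = e^δ.
  have hδε : (1 / (T : ℝ) ^ 2) ^ 2 ≤ 1 / (4 * (T : ℝ) ^ 3) := by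
    rw [div_pow, one_pow, ← pow_mul]
    refine one_div_le_one_div_of_le (by positivity) ?_
    have : (T : ℝ) ^ (2 * 2) = T * (T : ℝ) ^ 3 := by ring
    rw [this]
    exact mul_le_mul_of_nonneg_right (by linarith) (by positivity)
  have hδ : 1 / (T : ℝ) ^ 2 ≤ 1 / 4 :=
    one_div_le_one_div_of_le (by norm_num) (by nlinarith)
  -- The left side is 3·16/(200T³) = 0.24/T³. The slack value 0.45 makes T³ steps with factor 2q
  -- lose exactly 0.9.
  have hq : (1 / ((200 * T ^ 9 : ℕ) : ℝ) + 2 / ((200 * T ^ 9 : ℕ) : ℝ)) /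
      (1 / (4 * (T : ℝ) ^ 3)) ^ 2 ≤ 0.45 / (T : ℝ) ^ 3 := by
    push_cast
    rw [div_le_div_iff₀ (by positivity) (by positivity)]
    field_simp
    norm_num
  have key := Solves.sampleSteps.{u, v} (200 * T ^ 9) N (200 * T ^ 9) hθ hθ (1 / (T : ℝ) ^ 2)
    (1 / (4 * (T : ℝ) ^ 3)) (Real.exp (1 / (T : ℝ) ^ 2)) (0.45 / (T : ℝ) ^ 3) (by positivity)
    (by linarith) (by positivity) hεδ (Real.one_le_exp (by positivity)) (by
      have hd0 : 0 < 1 / (T : ℝ) ^ 2 := by positivity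
      have he0 : 0 < 1 / (4 * (T : ℝ) ^ 3) := by positivity
      have := Real.add_one_le_exp (1 / (T : ℝ) ^ 2)
      have h2 : 0 ≤ 1 - 1 / (T : ℝ) ^ 2 + 1 / (4 * (T : ℝ) ^ 3) := by linarith
      nlinarith [mul_le_mul_of_nonneg_left this h2, mul_pos hd0 he0])
    hq (T ^ 3) IL IU
  refine key.mono ?_
  intro U V _ _ H imp ident bad keep hs hL0 hU0 hi hN hL hU
  have hIU : 0 ≤ IU := (Finset.sum_nonneg fun x _ => hU0 x).trans hU
  obtain ⟨s1, s2, s3, s4⟩ := hs hL0 hU0 hi hN hL hU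
  have hup := sampling_upper_factor T hT' (T ^ 3) hm
  have hlow := sampling_lower_factor T hT' (T ^ 3) hm
  have hexp := two_hundred_mul_pow_le_exp T hT
  refine ⟨s1.trans ?_, s2.trans (le_of_eq ?_), fun x => ?_, fun x hx hd => ?_⟩
  · refine mul_le_mul_of_nonneg_right ?_ hIU
    have h1 : 1 + 2 * (0.45 / (T : ℝ) ^ 3) ≤ Real.exp (2 * (0.45 / (T : ℝ) ^ 3)) := by
      linarith [Real.add_one_le_exp (2 * (0.45 / (T : ℝ) ^ 3))]
    refine (pow_le_pow_left₀ (by positivity) h1 _).trans ?_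
    rw [← Real.exp_nat_mul, hm]
    have : (T : ℝ) ^ 3 * (2 * (0.45 / (T : ℝ) ^ 3)) = 0.9 := by field_simp; norm_num
    rw [this]
    have := Real.exp_le_exp.mpr (show (0.9 : ℝ) ≤ 1 by norm_num)
    linarith [Real.exp_one_lt_d9]
  · rw [hm]; field_simp; ring
  · rcases s3 x with h | h
    · refine le_max_of_le_right ?_
      have h1 : (degIn H x keep : ℝ) ≤ 200 * (T : ℝ) ^ 9 := by exact_mod_cast h.le
      exact h1.trans (hexp.trans (Real.exp_le_exp.mpr (by linarith)))
    · refine le_max_of_le_left (h.trans ?_)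
      rw [Real.exp_add, ← Real.exp_nat_mul, mul_one_div]
      gcongr
  · have h1 : Real.exp (-((T : ℝ) + 1)) * (nbU H x).card ≤
        (1 - 1 / (T : ℝ) ^ 2 - 1 / (4 * (T : ℝ) ^ 3)) ^ T ^ 3 * (nbU H x).card := by gcongr
    refine h1.trans (s4 x hx (le_trans ?_ h1))
    push_cast
    -- Even after shrinking by e^(−(T+1)), a degree of e^(100T) exceeds e^(15T), hence θ.
    refine hexp.trans (le_trans ?_ (mul_le_mul_of_nonneg_left hd (Real.exp_pos _).le))
    rw [← Real.exp_add, Real.exp_le_exp]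
    linarith

/-! ### Recursion on T_outer and T_rep -/

/-- A node of `U` of large degree with too few neighbours in `K`. -/
def Underfull {U : Type u} {V : Type v} [Fintype V] (T t : ℕ) (H : SimpleGraph (U ⊕ V)) (x : U)
    (K : V → Prop) : Prop :=
  (degIn H x K : ℝ) / (nbU H x).card < Real.exp (-((T : ℝ) + 1) * t) ∧
    Real.exp (((T : ℝ) + 1) * t) * Real.exp (100 * T) ≤ (nbU H x).card

theorem degIn_mono {U : Type u} {V : Type v} [Fintype V] (H : SimpleGraph (U ⊕ V)) (x : U)
    {K K' : V → Prop} (h : ∀ y, K y → K' y) : degIn H x K ≤ degIn H x K' :=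
  Finset.card_le_card (Finset.monotone_filter_right _ fun y _ => h y)

theorem degIn_or_le {U : Type u} {V : Type v} [Fintype V] (H : SimpleGraph (U ⊕ V)) (x : U)
    (K K' : V → Prop) : degIn H x (fun y => K y ∨ K' y) ≤ degIn H x K + degIn H x K' := by
  refine le_trans (Finset.card_le_card ?_) (Finset.card_union_le _ _)
  intro y
  simp only [Finset.mem_filter, Finset.mem_union]
  tauto

theorem Underfull.mono {U : Type u} {V : Type v} [Fintype V] {T t : ℕ} {H : SimpleGraph (U ⊕ V)}
    {x : U} {K K' : V → Prop} (h : Underfull T t H x K') (hK : ∀ y, K y → K' y) :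
    Underfull T t H x K := by
  refine ⟨lt_of_le_of_lt ?_ h.1, h.2⟩
  have : (degIn H x K : ℝ) ≤ degIn H x K' := by exact_mod_cast degIn_mono H x hK
  gcongr

/-- A good sampling loses at most a factor e^(−(T+1)), exactly the difference between the thresholds
for t + 1 and t. The remaining loss must occur in the branch inside the sampled set. -/
theorem Underfull.restrictGraph {U : Type u} {V : Type v} [Fintype V] {T t : ℕ}
    {H : SimpleGraph (U ⊕ V)} {x : U} {K K' : V → Prop}
    (h : Underfull T (t + 1) H x fun y => K y ∧ K' y)
    (hK : Real.exp (100 * T) ≤ (nbU H x).card →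
      Real.exp (-((T : ℝ) + 1)) * (nbU H x).card ≤ degIn H x K) :
    Underfull T t (restrictGraph H K) x K' := by
  obtain ⟨h1, h2⟩ := h
  have hE := Real.exp_pos (100 * T)
  have hd : Real.exp (100 * T) ≤ (nbU H x).card := by
    refine le_trans (le_mul_of_one_le_left hE.le (Real.one_le_exp ?_)) h2
    positivity
  have hk := hK hd
  have hd0 : (0 : ℝ) < (nbU H x).card := hE.trans_le hd
  have hk0 : (0 : ℝ) < degIn H x K := (mul_pos (Real.exp_pos _) hd0).trans_le hk
  rw [div_lt_iff₀ hd0] at h1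
  rw [Underfull, degIn_restrictGraph, card_nbU_restrictGraph]
  constructor
  · rw [div_lt_iff₀ hk0]
    refine h1.trans_le (le_trans (le_of_eq ?_) (mul_le_mul_of_nonneg_left hk (Real.exp_pos _).le))
    rw [← mul_assoc, ← Real.exp_add]
    push_cast
    ring_nf
  · refine le_trans (le_trans (le_of_eq ?_)
      (mul_le_mul_of_nonneg_left h2 (Real.exp_pos (-((T : ℝ) + 1))).le)) hk
    rw [← mul_assoc, ← Real.exp_add (-((T : ℝ) + 1))]
    congr 2
    push_cast
    ring

theorem degIn_union_le {U : Type u} {V : Type v} [Fintype V] (T To Tr : ℕ)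
    (H : SimpleGraph (U ⊕ V)) (x : U) (keep sub₁ sub₂ : V → Prop) (b b₁ b₂ : ℕ)
    (h : (degIn H x keep : ℝ) ≤
      max (Real.exp (-((T : ℝ) - 1) + b / (T : ℝ) ^ 2) * (nbU H x).card) (Real.exp (100 * T)))
    (h₁ : (degIn H x (fun y => keep y ∧ sub₁ y) : ℝ) ≤ ((Tr + 1 : ℕ) : ℝ) ^ To *
      max (Real.exp (-((T : ℝ) - 1) * To + b₁ / (T : ℝ) ^ 2) * degIn H x keep)
        (Real.exp (100 * T)))
    (h₂ : (degIn H x sub₂ : ℝ) ≤ (Tr : ℝ) ^ (To + 1) *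
      max (Real.exp (-((T : ℝ) - 1) * (To + 1 : ℕ) + b₂ / (T : ℝ) ^ 2) * (nbU H x).card)
        (Real.exp (100 * T))) :
    (degIn H x (fun y => (keep y ∧ sub₁ y) ∨ sub₂ y) : ℝ) ≤ ((Tr + 1 : ℕ) : ℝ) ^ (To + 1) *
      max (Real.exp (-((T : ℝ) - 1) * (To + 1 : ℕ) + (max (b + b₁) b₂ : ℕ) / (T : ℝ) ^ 2) *
        (nbU H x).card) (Real.exp (100 * T)) := by
  set G := max (Real.exp (-((T : ℝ) - 1) * (To + 1 : ℕ) + (max (b + b₁) b₂ : ℕ) / (T : ℝ) ^ 2) *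
        (nbU H x).card) (Real.exp (100 * T)) with hG
  have hEG : Real.exp (100 * T) ≤ G := le_max_right _ _
  have hG0 : 0 ≤ G := (Real.exp_pos _).le.trans hEG
  have hb : ∀ c : ℕ, c ≤ max (b + b₁) b₂ →
      Real.exp (-((T : ℝ) - 1) * (To + 1 : ℕ) + c / (T : ℝ) ^ 2) * (nbU H x).card ≤ G := by
    intro c hc
    refine le_max_of_le_left ?_
    have : (c : ℝ) ≤ (max (b + b₁) b₂ : ℕ) := by exact_mod_cast hc
    gcongr
  have e₁ : (degIn H x (fun y => keep y ∧ sub₁ y) : ℝ) ≤ ((Tr + 1 : ℕ) : ℝ) ^ To * G := by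
    -- If the sampled degree is at most e^(100T), it is itself a sufficient bound; otherwise the
    -- exponential term of `h` applies and the two rates multiply.
    rcases le_or_gt (degIn H x keep : ℝ) (Real.exp (100 * T)) with hk | hk
    · have : (degIn H x (fun y => keep y ∧ sub₁ y) : ℝ) ≤ degIn H x keep := by
        exact_mod_cast degIn_mono H x fun y (hy : keep y ∧ sub₁ y) => hy.1
      refine (this.trans (hk.trans hEG)).trans (le_mul_of_one_le_left hG0 (one_le_pow₀ ?_))
      push_cast
      linarith [Nat.cast_nonneg (α := ℝ) Tr]
    · have hk' := (le_max_iff.mp h).resolve_right (not_le.mpr hk)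
      refine h₁.trans (mul_le_mul_of_nonneg_left (max_le ?_ hEG) (by positivity))
      refine le_trans ?_ (hb (b + b₁) (le_max_left _ _))
      refine (mul_le_mul_of_nonneg_left hk' (Real.exp_pos _).le).trans (le_of_eq ?_)
      rw [← mul_assoc, ← Real.exp_add]
      push_cast
      ring_nf
  have e₂ : (degIn H x sub₂ : ℝ) ≤ (Tr : ℝ) * ((Tr + 1 : ℕ) : ℝ) ^ To * G := by
    refine h₂.trans (mul_le_mul ?_ (max_le (hb b₂ (le_max_right _ _)) hEG) ?_ (by positivity))
    · rw [pow_succ, mul_comm]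
      gcongr
      linarith
    · exact le_max_of_le_right (Real.exp_pos _).le
  have e₃ : (degIn H x (fun y => (keep y ∧ sub₁ y) ∨ sub₂ y) : ℝ) ≤
      degIn H x (fun y => keep y ∧ sub₁ y) + degIn H x sub₂ := by
    exact_mod_cast degIn_or_le H x _ _
  refine e₃.trans ((add_le_add e₁ e₂).trans (le_of_eq ?_))
  rw [pow_succ]
  push_cast
  ring

/-- The recursive sampling algorithm. -/
theorem Solves.outer (T N : ℕ) (hT : 10 ≤ T) (To Tr : ℕ) (IL IU : ℝ) :
    Solves ((To + Tr) * innerRounds T N) (fun (U : Type u) (V : Type v) _ _ H (imp : U → ℝ × ℝ)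
        (ident : V → ℕ) (bad : U → ℕ) (sub : V → Prop) =>
      (∀ x, 0 ≤ (imp x).1) → (∀ x, 0 ≤ (imp x).2) →
      Function.Injective ident → (∀ y, ident y ≤ N) →
      ∑ x, (imp x).1 ≤ IL → ∑ x, (imp x).2 ≤ IU →
        ∑ x, (imp x).2 * 2 ^ bad x ≤ 11 ^ (Tr + To) * IU ∧
        (∀ x, (degIn H x sub : ℝ) ≤ (Tr : ℝ) ^ To *
          max (Real.exp (-((T : ℝ) - 1) * To + bad x / (T : ℝ) ^ 2) * (nbU H x).card)
            (Real.exp (100 * T))) ∧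
        ∑ x, (if Underfull T To H x sub then (imp x).1 else 0) ≤
          ((Tr : ℝ) + 1) ^ To * 0.9 ^ Tr * IL) := by
  induction To generalizing Tr IL IU with
  | zero =>
    refine ((Solves.map.{u, v} (fun _ : ℝ × ℝ => 0) (fun _ : ℕ => True)).lift (Nat.zero_le _)).mono ?_
    rintro U V _ _ H imp ident _ _ ⟨rfl, rfl⟩ hL0 hU0 - - hL hU
    have hIL : 0 ≤ IL := (Finset.sum_nonneg fun x _ => hL0 x).trans hL
    have hIU : 0 ≤ IU := (Finset.sum_nonneg fun x _ => hU0 x).trans hU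
    have hx : ∀ x, ¬ Underfull T 0 H x (fun _ : V => True) := by
      rintro x ⟨h1, h2⟩
      have hd : (0 : ℝ) < (nbU H x).card := lt_of_lt_of_le (by positivity) h2
      simp [degIn, div_self hd.ne'] at h1
    refine ⟨?_, fun x => by simp [degIn], ?_⟩
    · simp only [pow_zero, mul_one]
      exact hU.trans (le_mul_of_one_le_left hIU (one_le_pow₀ (by norm_num)))
    · simp only [hx, if_false, Finset.sum_const_zero]
      positivity
  | succ To ihTo =>
    induction Tr generalizing IL IU with
    | zero =>
      -- With T_rep = 0 the degree bound is 0, which forces the empty set; the lower importance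
      -- bound is then all of `IL`.
      refine ((Solves.map.{u, v} (fun _ : ℝ × ℝ => 0) (fun _ : ℕ => False)).lift
        (Nat.zero_le _)).mono ?_
      rintro U V _ _ H imp ident _ _ ⟨rfl, rfl⟩ hL0 hU0 - - hL hU
      have hIU : 0 ≤ IU := (Finset.sum_nonneg fun x _ => hU0 x).trans hU
      refine ⟨?_, fun x => by simp [degIn], ?_⟩
      · simp only [pow_zero, mul_one]
        exact hU.trans (le_mul_of_one_le_left hIU (one_le_pow₀ (by norm_num)))
      · simp only [Nat.cast_zero, zero_add, one_pow, pow_zero, one_mul]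
        refine le_trans (Finset.sum_le_sum fun x _ => ?_) hL
        split_ifs
        exacts [le_rfl, hL0 x]
    | succ Tr ihTr =>
      have i1 := Solves.inner.{u, v} T N hT IL IU
      have i2 := (((ihTo (Tr + 1) IL (10 * IU)).restrict.premap
        (fun p : (ℝ × ℝ) × ℕ => (if p.2 = 0 then p.1.1 else 0, p.1.2 * 2 ^ p.2))
        (fun p : ℕ × Prop => p)).lift (r' := (To + Tr + 1) * innerRounds T N) (by rw [add_assoc]))
      have i3 := (((ihTr (0.9 * IL) IU).premap
        (fun p : (ℝ × ℝ) × ℕ => (if p.2 = 0 then 0 else p.1.1, p.1.2))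
        (fun p : ℕ × Prop => p.1)).lift (r' := (To + Tr + 1) * innerRounds T N)
          (by rw [add_right_comm]))
      -- Both branches share the rounds after the sampling. Taking the maximum of the two failure
      -- counts suffices for the union and costs at most the sum of their powers of 2.
      have i4 := i1.bind (fun p b => (p, b)) (fun i k => (i, k)) (i2.prod i3)
        (fun _ b q => max (b + q.1) q.2) (fun _ (k : Prop) q => (k ∧ q.1) ∨ q.2)
      refine (i4.lift (le_of_eq (by ring))).mono ?_
      rintro U V _ _ H imp ident _ _ ⟨b, keep, q, s, hi, ⟨ho₁, ho₂⟩, rfl, rfl⟩ hL0 hU0 hinj hN hL hU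
      have hIL : 0 ≤ IL := (Finset.sum_nonneg fun x _ => hL0 x).trans hL
      have hIU : 0 ≤ IU := (Finset.sum_nonneg fun x _ => hU0 x).trans hU
      obtain ⟨j1, j2, j3, j4⟩ := hi hL0 hU0 hinj hN hL hU
      obtain ⟨k1, k2, k3⟩ := ho₁
        (fun x => by have := hL0 x; dsimp only; split_ifs; exacts [this, le_rfl])
        (fun x => mul_nonneg (hU0 x) (by positivity)) hinj hN
        (le_trans (Finset.sum_le_sum fun x _ => by
          have := hL0 x; dsimp only; split_ifs; exacts [le_rfl, this]) hL) j1
      obtain ⟨l1, l2, l3⟩ := ho₂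
        (fun x => by have := hL0 x; dsimp only; split_ifs; exacts [le_rfl, this])
        hU0 hinj hN j2 hU
      simp only [degIn_restrictGraph, card_nbU_restrictGraph] at k2
      refine ⟨?_, fun x => ?_, ?_⟩
      · have : ∑ x, (imp x).2 * 2 ^ (max (b x + (q x).1) (q x).2) ≤
            ∑ x, (imp x).2 * 2 ^ b x * 2 ^ (q x).1 + ∑ x, (imp x).2 * 2 ^ (q x).2 := by
          rw [← Finset.sum_add_distrib]
          refine Finset.sum_le_sum fun x _ => ?_
          rw [mul_assoc, ← mul_add, ← pow_add]
          refine mul_le_mul_of_nonneg_left ?_ (hU0 x)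
          rcases max_choice (b x + (q x).1) (q x).2 with h | h <;> rw [h]
          · exact le_add_of_nonneg_right (by positivity)
          · exact le_add_of_nonneg_left (by positivity)
        -- The budgets 10·`IU` and `IU` of the branches come with the same power of 11, and 10 + 1 =
        -- 11.
        refine this.trans ((add_le_add k1 l1).trans (le_of_eq ?_))
        ring
      · exact degIn_union_le T To Tr H x keep _ _ (b x) _ _ (j3 x) (k2 x) (l2 x)
      · have : ∑ x, (if Underfull T (To + 1) H x (fun y => (keep y ∧ (s y).1) ∨ (s y).2)
              then (imp x).1 else 0) ≤
            ∑ x, (if Underfull T To (restrictGraph H keep) x (fun y => (s y).1) then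
              (if b x = 0 then (imp x).1 else 0) else 0) +
            ∑ x, (if Underfull T (To + 1) H x (fun y => (s y).2) then
              (if b x = 0 then 0 else (imp x).1) else 0) := by
          rw [← Finset.sum_add_distrib]
          refine Finset.sum_le_sum fun x _ => ?_
          have h0 := hL0 x
          by_cases hun : Underfull T (To + 1) H x (fun y => (keep y ∧ (s y).1) ∨ (s y).2)
          · by_cases hb : b x = 0
            -- A good node is charged to the branch inside the sample, a failed one to the restart.
            · have := (hun.mono (K := fun y => keep y ∧ (s y).1) fun y => Or.inl).restrictGraph
                (j4 x hb)
              simp [hb, this, hun]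
            · have := hun.mono (K := fun y => (s y).2) fun y => Or.inr
              simp [hb, this, hun]
          · rw [if_neg hun]
            positivity
        refine this.trans ((add_le_add k3 l3).trans ?_)
        -- With a = T_rep + 2 for the incremented parameter, a^To + (a − 1)^(To+1) ≤ a^(To+1).
        have hp : ((Tr : ℝ) + 1) ^ (To + 1) ≤ (Tr + 1) * ((Tr : ℝ) + 2) ^ To := by
          rw [pow_succ, mul_comm]
          gcongr
          linarith
        have hc : 0 ≤ 0.9 ^ Tr * (0.9 * IL) := by positivity
        have := mul_le_mul_of_nonneg_right hp hc
        push_cast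
        have e1 : ((Tr : ℝ) + 1 + 1) = Tr + 2 := by ring
        rw [e1, pow_succ (0.9 : ℝ) Tr, pow_succ ((Tr : ℝ) + 2) To]
        linarith

end Outer

/-! ### Round count and the final algorithm -/

section Main

open scoped Classical

theorem Solves.exists_localAlgorithm {X Y X' Y' : Type} [Nonempty X'] {r : ℕ}
    {S : Spec.{u, v} X Y X' Y'} (h : Solves r S) :
    ∃ A : LocalAlgorithm (X ⊕ Y) (X' ⊕ Y'), ∀ (U : Type u) (V : Type v) [Fintype U] [Fintype V]
      (H : SimpleGraph (U ⊕ V)), H ≤ completeBipartiteGraph U V → ∀ (a : U → X) (b : V → Y),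
      ∃ a' b', A.outputAfter H (Sum.map a b) r = Sum.map a' b' ∧ S U V H a b a' b' := by
  obtain ⟨f, hf⟩ := h
  refine ⟨viewAlgorithm r f, fun U V _ _ H hH a b => ?_⟩
  obtain ⟨a', b', h1, h2⟩ := hf U V H hH a b
  exact ⟨a', b', funext fun w => (viewAlgorithm_outputAfter r f H _ w).trans (h1 w), h2⟩

/-- The node `x` computes whether it is underfull. -/
theorem Solves.outer_underfull (T N : ℕ) (hT : 10 ≤ T) (To Tr : ℕ) (IL IU : ℝ) :
    Solves ((To + Tr) * innerRounds T N + 1) (fun (U : Type u) (V : Type v) _ _ H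
        (imp : U → ℝ × ℝ) (ident : V → ℕ) (out : U → ℕ × Prop) (sub : V → Prop) =>
      (∀ x, 0 ≤ (imp x).1) → (∀ x, 0 ≤ (imp x).2) →
      Function.Injective ident → (∀ y, ident y ≤ N) →
      ∑ x, (imp x).1 ≤ IL → ∑ x, (imp x).2 ≤ IU →
        (∀ x, (out x).2 ↔ Underfull T To H x sub) ∧
        ∑ x, (imp x).2 * 2 ^ (out x).1 ≤ 11 ^ (Tr + To) * IU ∧
        (∀ x, (degIn H x sub : ℝ) ≤ (Tr : ℝ) ^ To *
          max (Real.exp (-((T : ℝ) - 1) * To + (out x).1 / (T : ℝ) ^ 2) * (nbU H x).card)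
            (Real.exp (100 * T))) ∧
        ∑ x, (if (out x).2 then (imp x).1 else 0) ≤ ((Tr : ℝ) + 1) ^ To * 0.9 ^ Tr * IL) := by
  have h := (Solves.outer.{u, v} T N hT To Tr IL IU).comp (Solves.round
    (fun (b : ℕ) (ms : Multiset Prop) => (b,
      ((Multiset.card (ms.filter fun p => p) : ℕ) : ℝ) / (Multiset.card ms : ℕ) <
        Real.exp (-((T : ℝ) + 1) * To) ∧
      Real.exp (((T : ℝ) + 1) * To) * Real.exp (100 * T) ≤ (Multiset.card ms : ℕ)))
    (fun (p : Prop) (_ : Multiset ℕ) => p))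
  refine h.mono ?_
  rintro U V _ _ H imp ident _ _ ⟨bad, sub, hs, rfl, rfl⟩ hL0 hU0 hi hN hL hU
  obtain ⟨h1, h2, h3⟩ := hs hL0 hU0 hi hN hL hU
  have hiff : ∀ x, (((Multiset.card (((nbU H x).val.map sub).filter fun p => p) : ℕ) : ℝ) /
      (Multiset.card ((nbU H x).val.map sub) : ℕ) < Real.exp (-((T : ℝ) + 1) * To) ∧
      Real.exp (((T : ℝ) + 1) * To) * Real.exp (100 * T) ≤
        (Multiset.card ((nbU H x).val.map sub) : ℕ)) ↔ Underfull T To H x sub := by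
    intro x
    rw [Multiset.filter_map, Multiset.card_map, Multiset.card_map]
    rfl
  refine ⟨hiff, h1, h2, ?_⟩
  simp only [hiff]
  exact h3

theorem bipNbrs_eq {U : Type u} {V : Type v} [Fintype V] (H : SimpleGraph (U ⊕ V)) (x : U) :
    bipNbrs H x = nbU H x := by
  ext y; simp [bipNbrs, nbU]

theorem ncard_bipNbrs {U : Type u} {V : Type v} [Fintype V] (H : SimpleGraph (U ⊕ V)) (x : U) :
    (bipNbrs H x).ncard = (nbU H x).card := by
  rw [bipNbrs_eq, Set.ncard_coe_finset]

theorem ncard_bipNbrs_inter {U : Type u} {V : Type v} [Fintype V] (H : SimpleGraph (U ⊕ V)) (x : U)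
    (K : V → Prop) : (bipNbrs H x ∩ {y | K y}).ncard = degIn H x K := by
  rw [bipNbrs_eq, degIn, ← Set.ncard_coe_finset]
  congr 1
  ext y; simp

/-- The polynomial in the bound on the number of rounds. -/
noncomputable def roundPolynomial : Polynomial ℕ :=
  Polynomial.X ^ 3 * (Polynomial.C 6 + Polynomial.C 8192 * (Polynomial.C 200 * Polynomial.X ^ 9) ^ 4)
    + Polynomial.C 1

theorem rounds_le (T N t : ℕ) (ht : 0 < t) (hN : 0 < logStar N) :
    t * innerRounds T N + 1 ≤ t * roundPolynomial.eval T * logStar N := by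
  have h1 : innerRounds T N + 1 ≤ roundPolynomial.eval T * logStar N := by
    simp only [roundPolynomial, innerRounds, stepRounds, Polynomial.eval_add, Polynomial.eval_mul,
      Polynomial.eval_pow, Polynomial.eval_X, Polynomial.eval_C]
    generalize hK : (200 * T ^ 9) ^ 4 = K
    generalize T ^ 3 = m
    obtain ⟨s, hs⟩ := Nat.exists_eq_succ_of_ne_zero hN.ne'
    rw [hs]
    have : m * (1 + (2 * (s + 1) + 2) + 4096 * K * 2 + 1) ≤ m * ((6 + 8192 * K) * (s + 1)) := by
      refine Nat.mul_le_mul_left _ ?_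
      nlinarith [Nat.zero_le (K * s)]
    simp only [Nat.succ_eq_add_one]
    nlinarith
  have h2 := Nat.mul_le_mul_left t h1
  rw [mul_assoc]
  nlinarith

theorem le_one_of_logStar_eq_zero {N : ℕ} (h : logStar N = 0) : N ≤ 1 := by
  have := le_tower_logStar N
  rwa [h] at this

end Main

theorem mainTheorem5 :
    ∃ p : Polynomial ℕ,
      ∀ (N Tinner Touter Trep : ℕ) (IMPlow IMPup : ℝ),
        10 ≤ Tinner → 0 ≤ IMPlow → 0 ≤ IMPup →
        ∃ (A : LocalAlgorithm ((ℝ × ℝ) ⊕ ℕ) ((ℕ × Prop) ⊕ Prop)) (r : ℕ),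
          r ≤ (Touter + Trep) * p.eval Tinner * logStar N ∧
          ∀ (U V : Type*) [Fintype U] [Fintype V] (H : SimpleGraph (U ⊕ V))
            (ident : V → ℕ) (impLow impUp : U → ℝ),
            H ≤ completeBipartiteGraph U V →
            Function.Injective ident →
            (∀ v, ident v ∈ Finset.Icc 1 N) →
            (∀ u, 0 ≤ impLow u) → (∀ u, 0 ≤ impUp u) →
            ∑ u, impLow u ≤ IMPlow → ∑ u, impUp u ≤ IMPup →
            ∃ (Vsub : Set V) (bad : U → ℕ) (Ubad : Finset U),
              A.outputAfter H (Sum.map (fun u => (impLow u, impUp u)) ident) r =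
                Sum.map (fun u => (bad u, u ∈ Ubad)) (fun v => v ∈ Vsub) ∧
              ∑ u, impUp u * 2 ^ bad u ≤ 11 ^ (Trep + Touter) * IMPup ∧
              (∀ u, ((bipNbrs H u ∩ Vsub).ncard : ℝ) ≤
                (Trep : ℝ) ^ Touter *
                  max (Real.exp (-((Tinner : ℝ) - 1) * Touter + bad u / (Tinner : ℝ) ^ 2) *
                        (bipNbrs H u).ncard)
                      (Real.exp (100 * Tinner))) ∧
              (Ubad : Set U) = {u |
                ((bipNbrs H u ∩ Vsub).ncard : ℝ) / (bipNbrs H u).ncard <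
                    Real.exp (-((Tinner : ℝ) + 1) * Touter) ∧
                Real.exp (((Tinner : ℝ) + 1) * Touter) * Real.exp (100 * Tinner) ≤
                  (bipNbrs H u).ncard} ∧
              ∑ u ∈ Ubad, impLow u ≤ ((Trep : ℝ) + 1) ^ Touter * 0.9 ^ Trep * IMPlow := by
  classical
  refine ⟨roundPolynomial, fun N T To Tr IL IU hT hIL hIU => ?_⟩
  have main : ∃ (r : ℕ), r ≤ (To + Tr) * roundPolynomial.eval T * logStar N ∧
      Solves r (fun U V _ _ H (imp : U → ℝ × ℝ) (ident : V → ℕ) (out : U → ℕ × Prop)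
          (sub : V → Prop) =>
        (∀ x, 0 ≤ (imp x).1) → (∀ x, 0 ≤ (imp x).2) →
        Function.Injective ident → (∀ y, ident y ∈ Finset.Icc 1 N) →
        ∑ x, (imp x).1 ≤ IL → ∑ x, (imp x).2 ≤ IU →
          (∀ x, (out x).2 ↔ Underfull T To H x sub) ∧
          ∑ x, (imp x).2 * 2 ^ (out x).1 ≤ 11 ^ (Tr + To) * IU ∧
          (∀ x, (degIn H x sub : ℝ) ≤ (Tr : ℝ) ^ To *
            max (Real.exp (-((T : ℝ) - 1) * To + (out x).1 / (T : ℝ) ^ 2) * (nbU H x).card)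
              (Real.exp (100 * T))) ∧
          ∑ x, (if (out x).2 then (imp x).1 else 0) ≤ ((Tr : ℝ) + 1) ^ To * 0.9 ^ Tr * IL) := by
    by_cases htriv : To + Tr = 0 ∨ logStar N = 0
    · refine ⟨0, Nat.zero_le _, ?_⟩
      -- No rounds are available here. Keeping all of V works for T_outer = 0. Otherwise N ≤ 1,
      -- degrees are at most 1, and the empty set leaves no node underfull because underfull nodes
      -- have large degree.
      refine (Solves.map (fun _ : ℝ × ℝ => (0, False)) (fun _ : ℕ => To = 0)).mono ?_
      rintro U V _ _ H imp ident _ _ ⟨rfl, rfl⟩ hL0 hU0 hi hN hL hU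
      refine ⟨fun x => ?_, ?_, fun x => ?_, ?_⟩
      · refine iff_of_false id ?_
        rintro ⟨h1, h2⟩
        have hlarge : (1 : ℝ) < (nbU H x).card := by
          refine lt_of_lt_of_le ?_ h2
          rw [← Real.exp_add]
          refine Real.one_lt_exp_iff.mpr ?_
          positivity
        by_cases hTo : To = 0
        · have : ((nbU H x).card : ℝ) ≠ 0 := by linarith
          simp [hTo, degIn, div_self this] at h1
        · have hs : logStar N = 0 := by
            rcases htriv with h | h
            · omega
            · exact h
          have hN1 := le_one_of_logStar_eq_zero hs
          have : (nbU H x).card ≤ 1 := by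
            rw [Finset.card_le_one]
            intro y _ y' _
            have h1 := Finset.mem_Icc.mp (hN y)
            have h2 := Finset.mem_Icc.mp (hN y')
            exact hi (by omega)
          have : ((nbU H x).card : ℝ) ≤ 1 := by exact_mod_cast this
          linarith
      · simp only [pow_zero, mul_one]
        exact hU.trans (le_mul_of_one_le_left hIU (one_le_pow₀ (by norm_num)))
      · by_cases hTo : To = 0
        · simp [hTo, degIn]
        · simp only [hTo, degIn, Finset.filter_false, Finset.card_empty, Nat.cast_zero]
          exact mul_nonneg (by positivity) (le_max_of_le_right (Real.exp_pos _).le)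
      · simp only [if_false, Finset.sum_const_zero]
        positivity
    · push Not at htriv
      refine ⟨_, rounds_le T N (To + Tr) (by omega) (by omega),
        (Solves.outer_underfull T N hT To Tr IL IU).mono ?_⟩
      intro U V _ _ H imp ident out sub h hL0 hU0 hi hN
      exact h hL0 hU0 hi fun y => (Finset.mem_Icc.mp (hN y)).2
  obtain ⟨r, hr, hsolves⟩ := main
  obtain ⟨A, hA⟩ := hsolves.exists_localAlgorithm
  refine ⟨A, r, hr, fun U V _ _ H ident impLow impUp hH hi hN hL0 hU0 hL hU => ?_⟩
  obtain ⟨out, sub, hout, hs⟩ := hA U V H hH (fun u => (impLow u, impUp u)) ident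
  obtain ⟨h1, h2, h3, h4⟩ := hs hL0 hU0 hi hN hL hU
  refine ⟨{v | sub v}, fun u => (out u).1, Finset.univ.filter fun u => (out u).2, ?_, h2,
    fun u => ?_, ?_, ?_⟩
  · rw [hout]
    congr 1
    funext u
    simp
  · rw [ncard_bipNbrs_inter, ncard_bipNbrs]
    exact h3 u
  · ext u
    simp only [ncard_bipNbrs_inter, ncard_bipNbrs, Finset.coe_filter, Finset.mem_univ, true_and]
    exact h1 u
  · rw [Finset.sum_filter]
    convert h4
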